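/- Let $L,N\ge 1$ be integers, $\beta\ge 0$ an integer, and let $\nu$ be a $\sigma$-finite Borel measure on $\mathbb R$ such that $$Z_N=\frac1{N!}\int_{\mathbb R^N}\prod_{1\le m<n\le N}|\lambda_n-\lambda_m|^{\beta}\,d\nu^N(\lambda)$$ satisfies $0<Z_N<\infty$. Let $\mathbf p=(p_1,\dots,p_{NL})$ be any family of real monic polynomials with $\deg p_n=n-1$. Write $\mathbf e_1,\dots,\mathbf e_d$ for the standard basis of $\mathbb R^d$. For a strictly increasing $\mathfrak t:\{1,\dots,L\}\to\{1,\dots,NL\}$ put $\epsilon_{\mathfrak t}=\mathbf e_{\mathfrak t(1)}\wedge\cdots\wedge\mathbf e_{\mathfrak t(L)}$ and $$\mathrm{Wr}(\mathbf p_{\mathfrak t};x)=\det\Big[\tfrac1{(\ell-1)!}\,p_{\mathfrak t(n)}^{(\ell-1)}(x)\Big]_{n,\ell=1}^{L},\qquad \omega(x)=\sum_{\mathfrak t}\mathrm{Wr}(\mathbf p_{\mathfrak t};x)\,\epsilon_{\mathfrak t}\in\Lambda^L(\mathbb R^{NL}).$$ For a $k$-form $\alpha\in\Lambda^k(\mathbb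 R^{mk})$, $k\ge1$, the hyperpfaffian $\mathrm{PF}(\alpha)\in\mathbb R$ is defined by $\frac1{m!}\alpha^{\wedge m}=\mathrm{PF}(\alpha)\,\mathbf e_1\wedge\cdots\wedge\mathbf e_{mk}$. Integrals of form-valued functions are taken coefficientwise with respect to the standard basis of basic forms, and $\mathrm{sgn}(0)=0$. Let $\epsilon'=\mathbf e_{NL+1}\wedge\cdots\wedge\mathbf e_{NL+L}\in\Lambda^L(\mathbb R^{(N+1)L})$, and regard forms on $\mathbb R^{NL}$ as forms on $\mathbb R^{(N+1)L}$ through $\mathbf e_i\mapsto\mathbf e_i$. Then, in each of the following cases, all the integrals on the right-hand side converge absolutely, and: 1. if $\beta=L^2$ is even, $$Z_N=\mathrm{PF}\Big(\int_{\mathbb R}\omega(x)\,d\nu(x)\Big);$$ 2. if $\beta=L^2$ is odd and $N$ is even, $$Z_N=\mathrm{PF}\Big(\tfrac12\int_{\mathbb R}\int_{\mathbb R}\omega(x)\wedge\omega(y)\,\mathrm{sgn}(y-x)\,d\nu(x)\,d\nu(y)\Big);$$ 3. if $\beta=L^2$ is odd and $N$ is odd, $$Z_N=\mathrm{PF}\Big(\tfrac12\int_{\mathbb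 R}\int_{\mathbb R}\omega(x)\wedge\omega(y)\,\mathrm{sgn}(y-x)\,d\nu(x)\,d\nu(y)+\int_{\mathbb R}\omega(x)\wedge\epsilon'\,d\nu(x)\Big),$$ the hyperpfaffian being that of a $2L$-form on $\mathbb R^{(N+1)L}$; 4. if $\beta=L^2+1$ is even and $N=2M$ is even, $$Z_N=\mathrm{PF}\Big(\tfrac12\int_{\mathbb R}\int_{\mathbb R}\omega(x)\wedge\omega(y)\,\frac{(y^M-x^M)^2}{y-x}\,d\nu(x)\,d\nu(y)\Big),$$ where the quotient, a polynomial in $x,y$, is $0$ for $x=y$. -/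

import Mathlib

open MeasureTheory

noncomputable section

namespace HyperPf

/-- The space `Λ^k(ℝ^n)` of `k`-forms (`k`-vectors) over `ℝ^n`. -/
abbrev Form (n k : ℕ) : Type := ⋀[ℝ]^k (Fin n → ℝ)

/-- The standard basis vector `e_i` of `ℝ^n` (indices start at `0`). -/
def e {n : ℕ} (i : Fin n) : Fin n → ℝ := Pi.single i 1

/-- The basic form `e_{t(0)} ∧ e_{t(1)} ∧ ⋯ ∧ e_{t(k-1)}`. -/
def basicForm {n k : ℕ} (t : Fin k → Fin n) : Form n k :=
  exteriorPower.ιMulti ℝ k fun i => e (t i)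

/-- The exterior product of a `j`-form and a `k`-form. -/
def wedge {n j k : ℕ} (a : Form n j) (b : Form n k) : Form n (j + k) :=
  ⟨(a : ExteriorAlgebra ℝ (Fin n → ℝ)) * (b : ExteriorAlgebra ℝ (Fin n → ℝ)),
    SetLike.mul_mem_graded a.2 b.2⟩

/-- The volume form `e_0 ∧ e_1 ∧ ⋯ ∧ e_{n-1}` of `ℝ^n`. -/
def volForm (n : ℕ) : ExteriorAlgebra ℝ (Fin n → ℝ) :=
  ExteriorAlgebra.ιMulti ℝ n fun i : Fin n => e i

/-- The coefficient of the volume form in an element of the exterior algebra of `ℝ^n`: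
the linear functional that is `det` in degree `n` and `0` in all other degrees. -/
def volCoeff (n : ℕ) : ExteriorAlgebra ℝ (Fin n → ℝ) →ₗ[ℝ] ℝ :=
  ExteriorAlgebra.liftAlternating (Pi.single n Matrix.detRowAlternating)

/-- The hyperpfaffian of a `k`-form on `ℝ^n`, where `n = m * k`: the coefficient of the volume
form in `ω^{∧ m} / m!`; see `hyperpfaffian_spec`. -/
def hyperpfaffian {n k : ℕ} (ω : Form n k) : ℝ :=
  volCoeff n (((n / k).factorial : ℝ)⁻¹ • (ω : ExteriorAlgebra ℝ (Fin n → ℝ)) ^ (n / k))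

theorem volCoeff_volForm (n : ℕ) : volCoeff n (volForm n) = 1 := by
  unfold volCoeff volForm
  rw [ExteriorAlgebra.liftAlternating_apply_ιMulti, Pi.single_eq_same]
  have h : (fun i : Fin n => e i) = (1 : Matrix (Fin n) (Fin n) ℝ) := by
    ext i j
    simp [e, Matrix.one_apply, Pi.single_apply, eq_comm]
  rw [h]
  exact Matrix.det_one

theorem eq_volCoeff_smul {n : ℕ} {a : ExteriorAlgebra ℝ (Fin n → ℝ)}
    (ha : a ∈ ⋀[ℝ]^n (Fin n → ℝ)) : a = volCoeff n a • volForm n := by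
  rw [← ExteriorAlgebra.ιMulti_span_fixedDegree] at ha
  induction ha using Submodule.span_induction with
  | mem x hx =>
    obtain ⟨v, rfl⟩ := hx
    let A : (Fin n → ℝ) [⋀^Fin n]→ₗ[ℝ] ExteriorAlgebra ℝ (Fin n → ℝ) :=
      ExteriorAlgebra.ιMulti ℝ n
    let B : (Fin n → ℝ) [⋀^Fin n]→ₗ[ℝ] ExteriorAlgebra ℝ (Fin n → ℝ) :=
      (((volCoeff n).smulRight (volForm n))).compAlternatingMap (ExteriorAlgebra.ιMulti ℝ n)
    have hAB : A = B := by
      refine Module.Basis.ext_alternating (Pi.basisFun ℝ (Fin n)) fun i hi => ?_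
      let σ : Equiv.Perm (Fin n) := Equiv.ofBijective i (Finite.injective_iff_bijective.1 hi)
      have hv : (fun j => Pi.basisFun ℝ (Fin n) (i j)) = (fun j : Fin n => e j) ∘ σ := by
        funext j
        simp [σ, e]
      have h1 : A (fun j : Fin n => e j) = volForm n := rfl
      have h2 : B (fun j : Fin n => e j) = volForm n := by
        change volCoeff n (volForm n) • volForm n = volForm n
        rw [volCoeff_volForm, one_smul]
      rw [hv, AlternatingMap.map_perm, AlternatingMap.map_perm, h1, h2]
    exact congrArg (fun f => f v) hAB
  | zero => simp
  | add x y _ _ hx hy => rw [map_add, add_smul, ← hx, ← hy]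
  | smul c x _ hx => rw [map_smul, smul_assoc, ← hx]

/-- The defining property of the hyperpfaffian: `ω^{∧ m} / m! = PF(ω) · ε_vol`. -/
theorem hyperpfaffian_spec {n k m : ℕ} (hk : 0 < k) (hn : n = m * k) (ω : Form n k) :
    ((m.factorial : ℝ)⁻¹ • (ω : ExteriorAlgebra ℝ (Fin n → ℝ)) ^ m) =
      hyperpfaffian ω • volForm n := by
  have hm : n / k = m := by rw [hn]; exact Nat.mul_div_cancel _ hk
  have hmem : (ω : ExteriorAlgebra ℝ (Fin n → ℝ)) ^ m ∈ ⋀[ℝ]^n (Fin n → ℝ) := by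
    have h := SetLike.pow_mem_graded (A := fun i : ℕ => ⋀[ℝ]^i (Fin n → ℝ)) m ω.2
    rwa [smul_eq_mul, ← hn] at h
  unfold hyperpfaffian
  rw [hm]
  exact eq_volCoeff_smul (Submodule.smul_mem _ _ hmem)

/-- The basis `{ε_t}` of `Λ^k(ℝ^n)` formed by the increasing `k`-fold products of the `e_i`. -/
def formBasis (n k : ℕ) : Module.Basis (Set.powersetCard (Fin n) k) ℝ (Form n k) :=
  (Pi.basisFun ℝ (Fin n)).exteriorPower k

/-- A form-valued function is integrable if all its coefficient functions are. -/
def FormIntegrable {X : Type*} [MeasurableSpace X] {n k : ℕ} (μ : Measure X)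
    (F : X → Form n k) : Prop :=
  ∀ s, Integrable (fun x => (formBasis n k).repr (F x) s) μ

/-- The form with constant coefficients obtained by integrating the coefficients of `F`. -/
def formIntegral {X : Type*} [MeasurableSpace X] {n k : ℕ} (μ : Measure X)
    (F : X → Form n k) : Form n k :=
  (formBasis n k).equivFun.symm fun s => ∫ x, (formBasis n k).repr (F x) s ∂μ

/-- The normalized Wronskian `det [ p_{t(i)}^{(ℓ)}(x) / ℓ! ]_{i,ℓ}`, `0 ≤ ℓ < L`. -/
def wronskian {n L : ℕ} (p : Fin n → Polynomial ℝ) (t : Fin L → Fin n) (x : ℝ) : ℝ :=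
  Matrix.det (Matrix.of fun i l : Fin L =>
    ((l : ℕ).factorial : ℝ)⁻¹ * (Polynomial.derivative^[(l : ℕ)] (p (t i))).eval x)

/-- A complete family of monic polynomials: `p_i` is monic of degree `i`, for `0 ≤ i < n`. -/
def IsCompleteMonic {n : ℕ} (p : Fin n → Polynomial ℝ) : Prop :=
  ∀ i, (p i).Monic ∧ (p i).natDegree = (i : ℕ)

/-- The `L`-form `ω(x) = ∑_t Wr(p_t; x) ε_t`, over all increasing `t`. -/
def omega {n : ℕ} (L : ℕ) (p : Fin n → Polynomial ℝ) (x : ℝ) : Form n L :=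
  ∑ t : Fin L ↪o Fin n, wronskian p t x • basicForm t

/-- `Λ^k(ℝ^{NL}) → Λ^k(ℝ^{(N+1)L})`, induced by the inclusion `e_i ↦ e_i`. -/
def extendForm (N L : ℕ) {k : ℕ} : Form (N * L) k →ₗ[ℝ] Form ((N + 1) * L) k :=
  exteriorPower.map k (Function.ExtendByZero.linearMap ℝ
    (Fin.castLE (Nat.mul_le_mul_right L (Nat.le_succ N)) : Fin (N * L) → Fin ((N + 1) * L)))

/-- The form `ε' = e_{NL+1} ∧ ⋯ ∧ e_{NL+L}` on `ℝ^{(N+1)L}` (in indices starting at `1`). -/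
def borderForm (N L : ℕ) : Form ((N + 1) * L) L :=
  basicForm fun j : Fin L => ⟨N * L + j, by rw [Nat.succ_mul]; exact Nat.add_lt_add_left j.2 _⟩

/-- The partition function `Z_N = (1/N!) ∫ ∏_{m<n} |λ_n - λ_m|^β dν^N(λ)`, in `[0,∞]`. -/
def partitionFunction (N β : ℕ) (ν : Measure ℝ) : ENNReal :=
  (N.factorial : ENNReal)⁻¹ *
    ∫⁻ x : Fin N → ℝ, ENNReal.ofReal (∏ m, ∏ n ∈ Finset.Ioi m, |x n - x m| ^ β)
      ∂(Measure.pi fun _ => ν)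

/-- The integrand `k(x,y) ω(x) ∧ ω(y)` of the double integrals. -/
def pairForm {n : ℕ} (L : ℕ) (p : Fin n → Polynomial ℝ) (k : ℝ → ℝ → ℝ) (x y : ℝ) :
    Form n (L + L) :=
  k x y • wedge (omega L p x) (omega L p y)

/-- The `2L`-form `½ ∫ ∫ ω(x) ∧ ω(y) k(x,y) dν(x) dν(y)`. -/
def doubleForm {n : ℕ} (L : ℕ) (p : Fin n → Polynomial ℝ) (k : ℝ → ℝ → ℝ) (ν : Measure ℝ) :
    Form n (L + L) :=
  (1 / 2 : ℝ) • formIntegral ν fun y => formIntegral ν fun x => pairForm L p k x y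

end HyperPf

end

/-! Write `Δ(x)` for the Vandermonde determinant. The Wronskian coefficients of `ω(x)` are the `L ×
L` minors of the Taylor coefficients of the `p_i` at `x`, so `ω(x)` is decomposable: the wedge of
the first `L` Taylor coefficient vectors (`omega_eq_ιMulti`). Hence `ω(x_1) ∧ ⋯ ∧ ω(x_N)` is a
confluent Vandermonde determinant times the volume form, and this determinant is `Δ(x)^(L^2)`
(`det_confluentVandermonde`).

By Fubini in the exterior algebra, the `N`-th power of `∫ ω` has volume coefficient `∫ Δ^(L^2)`. For
`L^2` even the integrand is `|Δ|^(L^2)`, which is case 1.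

For `L^2` odd, the `M`-th power of the double integral without its factor ½ gives `∫ w Δ^(L^2)` with
`w = k(x_1,x_2) k(x_3,x_4) ⋯`. The measure is symmetric and `Δ^(L^2)` alternating, so only the
signed sum of `w` over permutations matters (`factorial_mul_integral_mul_det_pow`). That sum is a
volume coefficient of a power of `∑ k(x_i,x_j) e_i ∧ e_j`. For the sign kernel it equals `2^M M! sgn
Δ` at distinct points; for `(y^M - x^M)^2/(y - x)` it equals `2^M M! Δ`. The result is `|Δ|^(L^2)`,
respectively `Δ^(L^2+1)`. For odd `N` one variable stays unpaired, and wedging its `ω` with `ε'`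
turns it into a `2L`-form that occurs exactly once in the top power
(`hyperpfaffian_extendForm_add`).

Convergence comes from `0 < Z_N < ∞` alone: slicing the integral in one variable yields all moments
up to degree `β(N-1)` (`integrable_abs_pow_mul`), while the Wronskians have degree at most `L^2
(N-1)`. -/

noncomputable section
namespace HyperPf

/-! ### Confluent Vandermonde determinants -/

open Polynomial in
/-- The determinant of a matrix `φ_r(p_i)`, for linear functionals `φ_r`, is the same for every
complete family `p` of monic polynomials. -/
theorem det_functional_monic {R : Type*} [CommRing R] {n : ℕ} (φ : Fin n → R[X] →ₗ[R] R)
    (p : Fin n → R[X]) (hdeg : ∀ i, (p i).natDegree = i) (hmonic : ∀ i, (p i).Monic) :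
    (Matrix.of fun r i => φ r (p i)).det = (Matrix.of fun r i : Fin n => φ r (X ^ (i : ℕ))).det := by
  have h : (Matrix.of fun r i => φ r (p i)) =
      (Matrix.of fun r i : Fin n => φ r (X ^ (i : ℕ))) *
        (Matrix.of fun i j : Fin n => (p j).coeff i) := by
    ext r i
    simp only [Matrix.mul_apply, Matrix.of_apply]
    conv_lhs => rw [(p i).as_sum_range' n (by rw [hdeg]; exact i.2)]
    rw [map_sum, Finset.sum_range]
    refine Finset.sum_congr rfl fun j _ => ?_
    rw [← C_mul_X_pow_eq_monomial, ← smul_eq_C_mul, map_smul, smul_eq_mul, mul_comm]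
  rw [h, Matrix.det_mul, Matrix.det_matrixOfPolynomials p hdeg hmonic, mul_one]

open Polynomial in
/-- The confluent Vandermonde matrix: row `j + L * m` lists the `j`-th Taylor coefficients of the
`p_i` at `x_m`. -/
def confluentVandermonde {R : Type*} [CommRing R] {N : ℕ} (L : ℕ) (x : Fin N → R)
    (p : Fin (N * L) → R[X]) : Matrix (Fin (N * L)) (Fin (N * L)) R :=
  Matrix.of fun r i => (taylor (x r.divNat) (p i)).coeff r.modNat

open Polynomial in
-- The convolution formula for coefficients, padded by zeros to a sum over all of `Fin L` so that it
-- reads as a matrix product.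
theorem taylor_coeff_mul_eq_sum {R : Type*} [CommRing R] (L : ℕ) (y : R) (f g : R[X]) (l : Fin L) :
    (taylor y (f * g)).coeff l =
      ∑ s : Fin L, (if s ≤ l then (taylor y f).coeff (l - s : ℕ) else 0) * (taylor y g).coeff s := by
  simp only [Fin.le_def]
  rw [taylor_mul, mul_comm, coeff_mul, Finset.Nat.sum_antidiagonal_eq_sum_range_succ_mk,
    Fin.sum_univ_eq_sum_range
      (fun s => (if s ≤ l then (taylor y f).coeff (l - s : ℕ) else 0) * (taylor y g).coeff s)]
  have hsub : Finset.range (l + 1) ⊆ Finset.range L := by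
    intro s; simp only [Finset.mem_range]; omega
  rw [← Finset.sum_subset hsub]
  · refine Finset.sum_congr rfl fun s hs => ?_
    rw [Finset.mem_range] at hs
    rw [if_pos (by omega), mul_comm]
  · intro s _ hs
    rw [Finset.mem_range] at hs
    rw [if_neg (by omega), zero_mul]

open Polynomial in
/-- The matrix of multiplication by `f` acting on Taylor coefficients at the points `x_m`. -/
def taylorMulMatrix {R : Type*} [CommRing R] {N : ℕ} (L : ℕ) (x : Fin N → R) (f : R[X]) :
    Matrix (Fin (N * L)) (Fin (N * L)) R :=
  Matrix.of fun r s => if r.divNat = s.divNat then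
    (if s.modNat ≤ r.modNat then
      (taylor (x r.divNat) f).coeff (r.modNat - s.modNat : ℕ) else 0) else 0

open Polynomial in
theorem confluentVandermonde_mul {R : Type*} [CommRing R] {N : ℕ} (L : ℕ) (x : Fin N → R)
    (f : R[X]) (p : Fin (N * L) → R[X]) :
    confluentVandermonde L x (fun i => f * p i) =
      taylorMulMatrix L x f * confluentVandermonde L x p := by
  ext r i
  simp only [confluentVandermonde, taylorMulMatrix, Matrix.mul_apply, Matrix.of_apply]
  rw [← finProdFinEquiv.sum_comp, Fintype.sum_prod_type, Finset.sum_eq_single r.divNat]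
  · rw [taylor_coeff_mul_eq_sum]
    refine Finset.sum_congr rfl fun s _ => ?_
    have h := finProdFinEquiv.symm_apply_apply (r.divNat, s)
    simp only [finProdFinEquiv_symm_apply, Prod.mk.injEq] at h
    rw [h.1, h.2, if_pos rfl]
  · intro m _ hm
    refine Finset.sum_eq_zero fun s _ => ?_
    have h := finProdFinEquiv.symm_apply_apply (m, s)
    simp only [finProdFinEquiv_symm_apply, Prod.mk.injEq] at h
    rw [h.1, if_neg hm.symm, zero_mul]
  · simp

open Polynomial in
-- The matrix is block diagonal with lower triangular Toeplitz blocks, and the diagonal of block `m`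
-- is constantly `f(x_m)`.
theorem det_taylorMulMatrix {R : Type*} [CommRing R] {N : ℕ} (L : ℕ) (x : Fin N → R) (f : R[X]) :
    (taylorMulMatrix L x f).det = ∏ m, f.eval (x m) ^ L := by
  rw [Matrix.det_of_isLowerTriangular, ← finProdFinEquiv.prod_comp, Fintype.prod_prod_type]
  · refine Finset.prod_congr rfl fun m _ => ?_
    have : ∀ l : Fin L, taylorMulMatrix L x f (finProdFinEquiv (m, l)) (finProdFinEquiv (m, l)) =
        f.eval (x m) := by
      intro l
      have h := finProdFinEquiv.symm_apply_apply (m, l)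
      simp only [finProdFinEquiv_symm_apply, Prod.mk.injEq] at h
      simp [taylorMulMatrix, h.1]
    simp [this]
  · intro r s hrs
    simp only [taylorMulMatrix, Matrix.of_apply]
    split_ifs with h1 h2
    · exfalso
      have hrs' : (r : ℕ) < s := hrs
      have h1' : (r : ℕ) / L = s / L := congrArg Fin.val h1
      have h2' : (s : ℕ) % L ≤ r % L := h2
      have := Nat.div_add_mod (r : ℕ) L
      have := Nat.div_add_mod (s : ℕ) L
      rw [h1'] at *
      omega
    · rfl
    · rfl

open Polynomial in
-- Induction on the number of points. Since the determinant does not depend on the monic family, one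
-- adapted to `a = x 0` may be used: `(X - a)^i` for `i < L`, then `(X - a)^L X^(i-L)`. The rows at
-- `a` become the identity followed by zeros. In the complementary block the common factor `(X -
-- a)^L` comes out as `∏ (x_m - a)^(L^2)`, leaving the same determinant for the remaining points.
theorem det_confluentVandermonde {R : Type*} [CommRing R] {N : ℕ} (L : ℕ) (x : Fin N → R)
    (p : Fin (N * L) → R[X]) (hdeg : ∀ i, (p i).natDegree = i) (hmonic : ∀ i, (p i).Monic) :
    (confluentVandermonde L x p).det = ∏ m, ∏ n ∈ Finset.Ioi m, (x n - x m) ^ L ^ 2 := by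
  nontriviality R
  have base {n : ℕ} (L : ℕ) (x : Fin n → R) (p : Fin (n * L) → R[X])
      (hdeg : ∀ i, (p i).natDegree = i) (hmonic : ∀ i, (p i).Monic) :
      (confluentVandermonde L x p).det = (confluentVandermonde L x fun i => X ^ (i : ℕ)).det :=
    det_functional_monic (fun r => lcoeff R r.modNat ∘ₗ (taylor (x r.divNat))) p hdeg hmonic
  rw [base L x p hdeg hmonic]
  clear hdeg hmonic p
  induction N with
  | zero =>
    have : IsEmpty (Fin (0 * L)) := by rw [Nat.zero_mul]; infer_instance
    simp
  | succ N ih =>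
    set a := x 0
    let q : Fin ((N + 1) * L) → R[X] := fun i =>
      if (i : ℕ) < L then (X - C a) ^ (i : ℕ) else (X - C a) ^ L * X ^ (i - L : ℕ)
    have hq : ∀ i, (q i).natDegree = i ∧ (q i).Monic := by
      intro i
      simp only [q]
      split_ifs with h
      · exact ⟨by rw [(monic_X_sub_C a).natDegree_pow, natDegree_X_sub_C, mul_one], (monic_X_sub_C a).pow _⟩
      · refine ⟨?_, ((monic_X_sub_C a).pow _).mul (monic_X_pow _)⟩
        rw [((monic_X_sub_C a).pow _).natDegree_mul (monic_X_pow _), (monic_X_sub_C a).natDegree_pow, natDegree_X_sub_C, mul_one,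
          natDegree_X_pow]
        omega
    rw [← base L x q (fun i => (hq i).1) (fun i => (hq i).2)]
    let e : Fin L ⊕ Fin (N * L) ≃ Fin ((N + 1) * L) :=
      finSumFinEquiv.trans (finCongr (by ring))
    have hel : ∀ i : Fin L, ((e (Sum.inl i) : Fin _) : ℕ) = i := fun i => rfl
    have her : ∀ i : Fin (N * L), ((e (Sum.inr i) : Fin _) : ℕ) = L + i := fun i => rfl
    have hdl : ∀ i : Fin L, (e (Sum.inl i)).divNat = 0 ∧ ((e (Sum.inl i)).modNat : ℕ) = i := by
      intro i
      refine ⟨Fin.ext ?_, ?_⟩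
      · simp [Fin.divNat, hel, Nat.div_eq_of_lt i.2]
      · simp [Fin.modNat, hel, Nat.mod_eq_of_lt i.2]
    have hdr : ∀ i : Fin (N * L), (e (Sum.inr i)).divNat = i.divNat.succ ∧
        (e (Sum.inr i)).modNat = i.modNat := by
      intro i
      have hL : 0 < L := Nat.pos_of_ne_zero fun h => by
        subst h; exact absurd i.2 (by simp)
      refine ⟨Fin.ext ?_, Fin.ext ?_⟩
      · simp [Fin.divNat, her, Nat.add_div_left _ hL]
      · simp [Fin.modNat, her]
    rw [← Matrix.det_submatrix_equiv_self e]
    have hblock : (confluentVandermonde L x q).submatrix e e = Matrix.fromBlocks 1 0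
        (Matrix.of fun r i => confluentVandermonde L x q (e (Sum.inr r)) (e (Sum.inl i)))
        (confluentVandermonde L (Fin.tail x) fun i => (X - C a) ^ L * X ^ (i : ℕ)) := by
      ext r i
      rcases r with r | r <;> rcases i with i | i
      · simp only [Matrix.submatrix_apply, Matrix.fromBlocks_apply₁₁, confluentVandermonde,
          Matrix.of_apply, hdl, q, hel, if_pos i.2]
        rw [taylor_pow, map_sub, taylor_X, taylor_C, add_sub_cancel_right, coeff_X_pow,
          Matrix.one_apply]
        simp [Fin.ext_iff]
      · simp only [Matrix.submatrix_apply, Matrix.fromBlocks_apply₁₂, confluentVandermonde,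
          Matrix.of_apply, hdl, q, her]
        rw [if_neg (by omega), taylor_mul, taylor_pow, map_sub, taylor_X, taylor_C,
          add_sub_cancel_right, coeff_X_pow_mul', if_neg (by omega)]
        rfl
      · rfl
      · simp only [Matrix.submatrix_apply, Matrix.fromBlocks_apply₂₂, confluentVandermonde,
          Matrix.of_apply, hdr, q, her]
        rw [if_neg (by omega), Nat.add_sub_cancel_left]
        rfl
    rw [hblock, Matrix.det_fromBlocks_zero₁₂, Matrix.det_one, one_mul, confluentVandermonde_mul,
      Matrix.det_mul, det_taylorMulMatrix, ih, Fin.prod_univ_succ]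
    congr 1
    · rw [Fin.prod_Ioi_zero]
      refine Finset.prod_congr rfl fun m _ => ?_
      rw [eval_pow, eval_sub, eval_X, eval_C, ← pow_mul, sq]
      rfl
    · refine Finset.prod_congr rfl fun m _ => ?_
      rw [Fin.prod_Ioi_succ]
      rfl

/-! ### Decomposability of `ω` and products of its values -/

/-- The vector of the `l`-th Taylor coefficients of the `p_i` at `x`. -/
def jet {n : ℕ} (p : Fin n → Polynomial ℝ) (x : ℝ) (l : ℕ) : Fin n → ℝ :=
  fun i => (Polynomial.taylor x (p i)).coeff l

theorem wronskian_eq_det_jet {n L : ℕ} (p : Fin n → Polynomial ℝ) (t : Fin L → Fin n) (x : ℝ) :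
    wronskian p t x = Matrix.det (Matrix.of fun i l : Fin L => jet p x l (t i)) := by
  unfold wronskian
  congr 1
  ext i l
  simp only [Matrix.of_apply, jet]
  rw [Polynomial.taylor_coeff, ← Polynomial.factorial_smul_hasseDeriv, LinearMap.smul_apply,
    nsmul_eq_mul, Polynomial.eval_natCast_mul, ← mul_assoc, inv_mul_cancel₀, one_mul]
  exact_mod_cast Nat.factorial_ne_zero _

/-- `ω(x)` is the decomposable form given by the successive Taylor coefficients at `x`. -/
theorem omega_eq_ιMulti {n : ℕ} (L : ℕ) (p : Fin n → Polynomial ℝ) (x : ℝ) :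
    omega L p x = exteriorPower.ιMulti ℝ L fun l : Fin L => jet p x l := by
  -- The coordinates of a decomposable form in the standard basis are its `L × L` minors, here the
  -- Wronskians.
  rw [← (formBasis n L).sum_repr (exteriorPower.ιMulti ℝ L fun l : Fin L => jet p x l),
    ← Set.powersetCard.ofFinEmbEquiv.sum_comp]
  refine Finset.sum_congr rfl fun t _ => ?_
  congr 1
  · unfold formBasis
    rw [exteriorPower.basis_repr_apply, exteriorPower.ιMultiDual_apply_ιMulti,
      wronskian_eq_det_jet, ← Matrix.det_transpose]
    congr 1
    ext i l
    simp
  · unfold formBasis basicForm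
    rw [exteriorPower.basis_apply, exteriorPower.ιMulti_family]
    congr 1
    ext i j
    simp [e]

theorem coe_omega {n : ℕ} (L : ℕ) (p : Fin n → Polynomial ℝ) (x : ℝ) :
    (omega L p x : ExteriorAlgebra ℝ (Fin n → ℝ)) =
      ExteriorAlgebra.ιMulti ℝ L fun l : Fin L => jet p x l := by
  rw [omega_eq_ιMulti, exteriorPower.ιMulti_apply_coe]

theorem volCoeff_ιMulti {n : ℕ} (v : Fin n → Fin n → ℝ) :
    volCoeff n (ExteriorAlgebra.ιMulti ℝ n v) = Matrix.det (Matrix.of v) := by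
  unfold volCoeff
  rw [ExteriorAlgebra.liftAlternating_apply_ιMulti, Pi.single_eq_same]
  rfl

theorem prod_ιMulti {N L : ℕ} {M : Type*} [AddCommGroup M] [Module ℝ M] (v : Fin N → Fin L → M) :
    (List.ofFn fun m => ExteriorAlgebra.ιMulti ℝ L (v m)).prod =
      ExteriorAlgebra.ιMulti ℝ (N * L) fun r => v r.divNat r.modNat := by
  simp only [ExteriorAlgebra.ιMulti_apply]
  rw [List.ofFn_mul, List.prod_flatten, List.map_ofFn]
  congr 2
  ext m
  simp only [Function.comp]
  congr 2
  ext l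
  have h := finProdFinEquiv.symm_apply_apply (m, l)
  simp only [finProdFinEquiv_symm_apply, Prod.mk.injEq] at h
  have h' : (⟨m * L + l, by
      calc m * L + l < (m + 1) * L := by rw [Nat.add_mul, one_mul]; omega
        _ ≤ N * L := Nat.mul_le_mul_right _ m.2⟩ : Fin (N * L)) = finProdFinEquiv (m, l) := by
    ext; simp [finProdFinEquiv]; ring
  rw [h', h.1, h.2]

/-- Concatenating the Taylor coefficient vectors at all the points lists the rows of the confluent
Vandermonde matrix. -/
theorem volCoeff_prod_omega {N L : ℕ} (p : Fin (N * L) → Polynomial ℝ) (hp : IsCompleteMonic p)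
    (x : Fin N → ℝ) :
    volCoeff (N * L) (List.ofFn fun m =>
      (omega L p (x m) : ExteriorAlgebra ℝ (Fin (N * L) → ℝ))).prod =
      ∏ m, ∏ n ∈ Finset.Ioi m, (x n - x m) ^ L ^ 2 := by
  simp only [coe_omega]
  rw [prod_ιMulti, volCoeff_ιMulti,
    ← det_confluentVandermonde L x p (fun i => (hp i).2) (fun i => (hp i).1)]
  rfl

/-! ### Weak integrals and Fubini for algebra-valued functions -/

/-- `I` is the weak integral of `F`: every linear functional commutes with the integration. -/
def HasWeakIntegral {X V : Type*} [MeasurableSpace X] [AddCommGroup V] [Module ℝ V]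
    (μ : Measure X) (F : X → V) (I : V) : Prop :=
  ∀ φ : V →ₗ[ℝ] ℝ, Integrable (fun x => φ (F x)) μ ∧ ∫ x, φ (F x) ∂μ = φ I

namespace HasWeakIntegral

variable {X Y V W ι : Type*} [MeasurableSpace X] [MeasurableSpace Y] [AddCommGroup V] [Module ℝ V]
  [AddCommGroup W] [Module ℝ W] [Fintype ι] {μ : Measure X} {ν : Measure Y}

theorem map {F : X → V} {I : V} (h : HasWeakIntegral μ F I) (f : V →ₗ[ℝ] W) :
    HasWeakIntegral μ (fun x => f (F x)) (f I) :=
  fun φ => h (φ ∘ₗ f)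

theorem of_sum (f : ι → X → ℝ) (a : ι → V) (hf : ∀ i, Integrable (f i) μ) :
    HasWeakIntegral μ (fun x => ∑ i, f i x • a i) (∑ i, (∫ x, f i x ∂μ) • a i) := by
  intro φ
  simp only [map_sum, map_smul, smul_eq_mul]
  refine ⟨integrable_finsetSum _ fun i _ => (hf i).mul_const _, ?_⟩
  rw [integral_finsetSum _ fun i _ => (hf i).mul_const _]
  exact Finset.sum_congr rfl fun i _ => integral_mul_const _ _

theorem comp_measurableEquiv {G : Y → V} {I : V} (h : HasWeakIntegral ν G I) (e : X ≃ᵐ Y)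
    (he : MeasurePreserving e μ ν) : HasWeakIntegral μ (fun x => G (e x)) I := by
  intro φ
  refine ⟨(he.integrable_comp_emb e.measurableEmbedding).2 (h φ).1, ?_⟩
  rw [← (h φ).2]
  exact he.integral_comp e.measurableEmbedding fun y => φ (G y)

/-- Multiplication is bilinear, so expanding both factors in a finite basis reduces the claim to
Fubini for products of scalar functions. -/
theorem mul {A : Type*} [Ring A] [Algebra ℝ A] [Module.Finite ℝ A] [SFinite μ] [SFinite ν]
    {F : X → A} {G : Y → A} {I J : A} (hF : HasWeakIntegral μ F I) (hG : HasWeakIntegral ν G J) :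
    HasWeakIntegral (μ.prod ν) (fun z => F z.1 * G z.2) (I * J) := by
  intro φ
  let b := Module.Free.chooseBasis ℝ A
  have key : ∀ u v : A, φ (u * v) = ∑ i, ∑ j, (b.coord i u * b.coord j v) * φ (b i * b j) := by
    intro u v
    conv_lhs => rw [← b.sum_repr u, ← b.sum_repr v]
    simp only [Finset.sum_mul_sum, map_sum, Algebra.smul_mul_assoc, Algebra.mul_smul_comm, map_smul,
      smul_eq_mul, Module.Basis.coord_apply]
    exact Finset.sum_congr rfl fun i _ => Finset.sum_congr rfl fun j _ => by ring
  have hint : ∀ i j, Integrable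
      (fun z : X × Y => (b.coord i (F z.1) * b.coord j (G z.2)) * φ (b i * b j)) (μ.prod ν) :=
    fun i j => ((hF (b.coord i)).1.mul_prod (hG (b.coord j)).1).mul_const _
  have hz : ∀ z : X × Y, φ (F z.1 * G z.2) =
      ∑ i, ∑ j, (b.coord i (F z.1) * b.coord j (G z.2)) * φ (b i * b j) := fun z => key _ _
  simp only [hz]
  rw [key I J]
  refine ⟨integrable_finsetSum _ fun i _ => integrable_finsetSum _ fun j _ => hint i j, ?_⟩
  rw [integral_finsetSum _ fun i _ => integrable_finsetSum _ fun j _ => hint i j]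
  refine Finset.sum_congr rfl fun i _ => ?_
  rw [integral_finsetSum _ fun j _ => hint i j]
  refine Finset.sum_congr rfl fun j _ => ?_
  rw [integral_mul_const, integral_prod_mul (fun x => b.coord i (F x)) (fun y => b.coord j (G y)),
    (hF (b.coord i)).2, (hG (b.coord j)).2]

theorem pi_succ {ν : Measure Y} [SigmaFinite ν] {n : ℕ} {G : Y × (Fin n → Y) → V} {I : V}
    (h : HasWeakIntegral (ν.prod (Measure.pi fun _ : Fin n => ν)) G I) :
    HasWeakIntegral (Measure.pi fun _ : Fin (n + 1) => ν) (fun x => G (x 0, Fin.tail x)) I := by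
  have := h.comp_measurableEquiv _ (measurePreserving_piFinSuccAbove (fun _ : Fin (n + 1) => ν) 0)
  simpa [MeasurableEquiv.piFinSuccAbove, Fin.removeNth_zero] using this

end HasWeakIntegral

theorem hasWeakIntegral_pi_zero {Y V : Type*} [MeasurableSpace Y] [AddCommGroup V] [Module ℝ V]
    (ν : Measure Y) [SigmaFinite ν] (a : V) :
    HasWeakIntegral (Measure.pi fun _ : Fin 0 => ν) (fun _ => a) a := by
  intro φ
  rw [Measure.pi_of_empty]
  exact ⟨integrable_const _, by simp⟩

theorem HasWeakIntegral.prod_pi {Y A : Type*} [MeasurableSpace Y] [Ring A] [Algebra ℝ A]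
    [Module.Finite ℝ A] {ν : Measure Y} [SigmaFinite ν] {F : Y → A} {I : A}
    (h : HasWeakIntegral ν F I) (N : ℕ) :
    HasWeakIntegral (Measure.pi fun _ : Fin N => ν) (fun x => (List.ofFn fun i => F (x i)).prod)
      (I ^ N) := by
  induction N with
  | zero => simpa using hasWeakIntegral_pi_zero ν (1 : A)
  | succ N ih =>
    simpa only [List.ofFn_succ, List.prod_cons, pow_succ', Fin.tail] using (h.mul ih).pi_succ

/-- The product `k(x_0,x_1) k(x_2,x_3) ⋯ k(x_{2M-2},x_{2M-1})`. -/
def pairWeight {Y : Type*} (k : Y → Y → ℝ) : (M : ℕ) → (Fin (2 * M) → Y) → ℝ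
  | 0, _ => 1
  | M + 1, x => k (x (0 : Fin (2 * M + 2))) (x (1 : Fin (2 * M + 2))) *
      pairWeight k M (Fin.tail (n := 2 * M) (Fin.tail (n := 2 * M + 1) x))

/-- Only the weighted product over a pair of variables is assumed to have an integral, not `F`
itself. -/
theorem HasWeakIntegral.prod_pairs {Y A : Type*} [MeasurableSpace Y] [Ring A] [Algebra ℝ A]
    [Module.Finite ℝ A] {ν : Measure Y} [SigmaFinite ν] {k : Y → Y → ℝ} {F : Y → A} {I : A}
    (h : HasWeakIntegral (ν.prod ν) (fun z => k z.1 z.2 • (F z.1 * F z.2)) I) (M : ℕ) :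
    HasWeakIntegral (Measure.pi fun _ : Fin (2 * M) => ν)
      (fun x => pairWeight k M x • (List.ofFn fun i => F (x i)).prod) (I ^ M) := by
  induction M with
  | zero => simpa [pairWeight] using hasWeakIntegral_pi_zero ν (1 : A)
  | succ M ih =>
    -- The space `(Y × Y) × Y^(2M)` is reassociated so that `pi_succ` can absorb the two new
    -- coordinates one at a time.
    have h1 := ((h.mul ih).comp_measurableEquiv MeasurableEquiv.prodAssoc.symm
      (measurePreserving_prodAssoc ν ν (Measure.pi fun _ : Fin (2 * M) => ν)).symm)
    have h2 : HasWeakIntegral (ν.prod (Measure.pi fun _ : Fin (2 * M + 1) => ν))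
        (fun z => (k z.1 (z.2 0) • (F z.1 * F (z.2 0))) *
          (pairWeight k M (Fin.tail z.2) • (List.ofFn fun i => F (Fin.tail z.2 i)).prod))
        (I * I ^ M) := by
      refine h1.comp_measurableEquiv ((MeasurableEquiv.refl Y).prodCongr
        (MeasurableEquiv.piFinSuccAbove (fun _ : Fin (2 * M + 1) => Y) 0)) ?_
      exact (MeasurePreserving.id ν).prod
        (measurePreserving_piFinSuccAbove (fun _ : Fin (2 * M + 1) => ν) 0)
    have h3 := h2.pi_succ
    rw [pow_succ']
    have hL : ∀ x : Fin (2 * M + 2) → Y, (List.ofFn fun i => F (x i)).prod =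
        F (x 0) * (F (x 1) * (List.ofFn fun i : Fin (2 * M) => F (x i.succ.succ)).prod) := by
      intro x
      rw [List.ofFn_succ, List.prod_cons, List.ofFn_succ, List.prod_cons]
      rfl
    refine (congrArg (fun f => HasWeakIntegral _ f _) (funext fun x => ?_)).mpr h3
    refine (congrArg _ (hL x)).trans ?_
    rw [pairWeight, smul_mul_smul_comm, mul_assoc]
    rfl

theorem FormIntegrable.hasWeakIntegral {X : Type*} [MeasurableSpace X] {n k : ℕ} {μ : Measure X}
    {F : X → Form n k} (h : FormIntegrable μ F) : HasWeakIntegral μ F (formIntegral μ F) := by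
  have := HasWeakIntegral.of_sum _ (formBasis n k) h
  simp only [Module.Basis.sum_repr] at this
  rwa [formIntegral, Module.Basis.equivFun_symm_apply]

theorem HasWeakIntegral.formIntegrable {X : Type*} [MeasurableSpace X] {n k : ℕ} {μ : Measure X}
    {F : X → Form n k} {I : Form n k} (h : HasWeakIntegral μ F I) : FormIntegrable μ F :=
  fun s => (h ((formBasis n k).coord s)).1

theorem HasWeakIntegral.formIntegral_eq {X : Type*} [MeasurableSpace X] {n k : ℕ} {μ : Measure X}
    {F : X → Form n k} {I : Form n k} (h : HasWeakIntegral μ F I) : formIntegral μ F = I := by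
  apply (formBasis n k).repr.injective
  ext s
  change (formBasis n k).coord s _ = (formBasis n k).coord s _
  rw [← (h.formIntegrable.hasWeakIntegral _).2, (h _).2]

theorem formIntegral_formIntegral {X Y : Type*} [MeasurableSpace X] [MeasurableSpace Y] {n k : ℕ}
    {μ : Measure X} {ν : Measure Y} [SFinite μ] [SFinite ν] {F : X → Y → Form n k}
    (h : FormIntegrable (μ.prod ν) fun z => F z.1 z.2) :
    (formIntegral ν fun y => formIntegral μ fun x => F x y) =
      formIntegral (μ.prod ν) fun z => F z.1 z.2 := by
  unfold formIntegral
  congr 1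
  ext s
  rw [integral_prod_symm _ (h s)]
  refine integral_congr_ae (Filter.Eventually.of_forall fun y => ?_)
  simp only [← Module.Basis.equivFun_apply, LinearEquiv.apply_symm_apply]

instance finite_exteriorAlgebra (n : ℕ) : Module.Finite ℝ (ExteriorAlgebra ℝ (Fin n → ℝ)) :=
  Module.Finite.of_basis (Pi.basisFun ℝ (Fin n)).ExteriorAlgebra

/-- The inclusion of the `k`-forms into the exterior algebra. -/
def formSubtype (n k : ℕ) : Form n k →ₗ[ℝ] ExteriorAlgebra ℝ (Fin n → ℝ) := Submodule.subtype _

theorem hasWeakIntegral_doubleForm {n L : ℕ} {p : Fin n → Polynomial ℝ} {k : ℝ → ℝ → ℝ}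
    {ν : Measure ℝ} [SFinite ν]
    (h : FormIntegrable (ν.prod ν) fun z => pairForm L p k z.1 z.2) :
    HasWeakIntegral (ν.prod ν)
      (fun z => k z.1 z.2 • ((omega L p z.1 : ExteriorAlgebra ℝ (Fin n → ℝ)) * (omega L p z.2)))
      ((2 : ℝ) • (doubleForm L p k ν : ExteriorAlgebra ℝ (Fin n → ℝ))) := by
  have h1 := h.hasWeakIntegral.map (formSubtype n (L + L))
  rw [doubleForm, formIntegral_formIntegral h, Submodule.coe_smul, smul_smul]
  norm_num
  exact h1

/-! ### Convergence: moments of `ν` and degrees of Wronskians -/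

/-- By Tonelli, almost every point has a finite slice integral in each of the finitely many
coordinate directions. As `∫ f ≠ 0`, the function cannot vanish at almost every such point. -/
theorem exists_forall_lintegral_update_ne_top {n : ℕ} {ν : Measure ℝ} [SigmaFinite ν]
    {f : (Fin (n + 1) → ℝ) → ENNReal} (hf : Measurable f)
    (h0 : ∫⁻ x, f x ∂(Measure.pi fun _ => ν) ≠ 0) (htop : ∫⁻ x, f x ∂(Measure.pi fun _ => ν) ≠ ⊤) :
    ∃ x, f x ≠ 0 ∧ ∀ i, ∫⁻ t, f (Function.update x i t) ∂ν ≠ ⊤ := by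
  have hae : ∀ i, ∀ᵐ x ∂(Measure.pi fun _ : Fin (n + 1) => ν),
      ∫⁻ t, f (Function.update x i t) ∂ν ≠ ⊤ := by
    intro i
    have mp := measurePreserving_piFinSuccAbove (fun _ : Fin (n + 1) => ν) i
    set e := MeasurableEquiv.piFinSuccAbove (fun _ : Fin (n + 1) => ℝ) i with he
    have hfe : Measurable fun z => f (e.symm z) := hf.comp e.symm.measurable
    have h1 : ∫⁻ z, f (e.symm z) ∂(ν.prod (Measure.pi fun _ : Fin n => ν)) ≠ ⊤ := by
      rw [← mp.lintegral_comp hfe]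
      simpa using htop
    rw [lintegral_prod_symm' _ hfe] at h1
    have h2 := ae_lt_top (hfe.lintegral_prod_left' ) h1
    have h3 := (Measure.quasiMeasurePreserving_snd (μ := ν)).ae h2
    have h4 := mp.quasiMeasurePreserving.ae h3
    filter_upwards [h4] with x hx
    have : ∀ t, e.symm (t, (e x).2) = Function.update x i t := by
      intro t
      simp [he, MeasurableEquiv.piFinSuccAbove, Fin.insertNthEquiv]
    simp only [this] at hx
    exact hx.ne
  by_contra! hcon
  apply h0
  rw [lintegral_eq_zero_iff hf]
  filter_upwards [ae_all_iff.2 hae] with x hx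
  by_contra hne
  obtain ⟨i, hi⟩ := hcon x hne
  exact hx i hi

theorem sum_pow_le_card_pow_mul_sum_pow {ι : Type*} [Fintype ι] [Nonempty ι] (a : ι → ℝ)
    (ha : ∀ i, 0 ≤ a i) (β : ℕ) :
    (∑ i, a i) ^ β ≤ (Fintype.card ι : ℝ) ^ β * ∑ i, a i ^ β := by
  obtain ⟨i₀, hi₀⟩ := Finite.exists_max a
  have h1 : ∑ i, a i ≤ Fintype.card ι * a i₀ := by
    calc ∑ i, a i ≤ ∑ _i : ι, a i₀ := Finset.sum_le_sum fun i _ => hi₀ i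
      _ = _ := by simp
  calc (∑ i, a i) ^ β ≤ (Fintype.card ι * a i₀) ^ β :=
        pow_le_pow_left₀ (Finset.sum_nonneg fun i _ => ha i) h1 β
    _ = (Fintype.card ι : ℝ) ^ β * a i₀ ^ β := mul_pow _ _ _
    _ ≤ _ := by
      gcongr
      exact Finset.single_le_sum (f := fun i => a i ^ β) (fun i _ => pow_nonneg (ha i) β)
        (Finset.mem_univ i₀)

theorem prod_abs_sub_pow {N : ℕ} (β : ℕ) (x : Fin N → ℝ) :
    ∏ m, ∏ n ∈ Finset.Ioi m, |x n - x m| ^ β = |(Matrix.vandermonde x).det| ^ β := by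
  rw [Matrix.det_vandermonde, Finset.abs_prod]
  simp only [Finset.abs_prod, Finset.prod_pow]

theorem continuous_abs_det_vandermonde_pow {N : ℕ} (β : ℕ) :
    Continuous fun x : Fin N → ℝ => |(Matrix.vandermonde x).det| ^ β := by
  simp only [Matrix.det_vandermonde]
  fun_prop

/-- The powers of `t` as combinations of Vandermonde determinants with one node moved to `t`. -/
theorem pow_mul_det_vandermonde {N : ℕ} (x : Fin N → ℝ) (t : ℝ) (k : Fin N) :
    t ^ (k : ℕ) * (Matrix.vandermonde x).det =
      ∑ i, x i ^ (k : ℕ) * (Matrix.vandermonde (Function.update x i t)).det := by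
  -- Cramer's rule for the transposed Vandermonde system with right-hand side `(t^k)_k`: replacing a
  -- column moves one node to `t`.
  have h := congrFun (Matrix.mulVec_cramer (Matrix.vandermonde x).transpose
    fun k : Fin N => t ^ (k : ℕ)) k
  simp only [Matrix.mulVec, dotProduct, Matrix.cramer_apply, Matrix.det_transpose,
    Pi.smul_apply, smul_eq_mul, Matrix.transpose_apply, Matrix.vandermonde_apply] at h
  rw [mul_comm, ← h]
  refine Finset.sum_congr rfl fun i _ => ?_
  rw [Matrix.updateCol_transpose, Matrix.det_transpose]
  congr 2
  ext j l
  by_cases hj : j = i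
  · subst hj; simp [Matrix.vandermonde_apply]
  · simp [Matrix.vandermonde_apply, hj]

/-- Fix `x` with `Δ(x) ≠ 0` and finite slices. By `pow_mul_det_vandermonde`, `t^k` is a combination
of the determinants with one node moved to `t`, whose `β`-th powers are integrable in `t` by the
choice of `x`. -/
theorem integrable_abs_pow_mul {N β : ℕ} {ν : Measure ℝ} [SigmaFinite ν]
    (hpos : 0 < partitionFunction N β ν) (hfin : partitionFunction N β ν < ⊤) (k : Fin N) :
    Integrable (fun t : ℝ => |t| ^ (k * β)) ν := by
  obtain ⟨n, rfl⟩ : ∃ n, N = n + 1 := ⟨N - 1, by have := k.2; omega⟩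
  simp only [partitionFunction, prod_abs_sub_pow] at hpos hfin
  have hfac : (((n + 1).factorial : ENNReal))⁻¹ ≠ 0 := by simp
  have hcont := continuous_abs_det_vandermonde_pow (N := n + 1) β
  obtain ⟨x, hx, hint⟩ := exists_forall_lintegral_update_ne_top (ν := ν)
    (ENNReal.measurable_ofReal.comp hcont.measurable)
    (fun h => by simp only [Function.comp_apply] at h; rw [h, mul_zero] at hpos; exact hpos.false)
    (fun h => by
      simp only [Function.comp_apply] at h
      rw [h, ENNReal.mul_top hfac] at hfin; exact hfin.false)
  simp only [Function.comp_apply] at hx hint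
  have hupd : ∀ i, Integrable
      (fun t => |(Matrix.vandermonde (Function.update x i t)).det| ^ β) ν := by
    intro i
    refine ⟨(hcont.comp (continuous_const.update i continuous_id)).aestronglyMeasurable, ?_⟩
    rw [hasFiniteIntegral_iff_ofReal (Filter.Eventually.of_forall fun t => by positivity)]
    exact (hint i).lt_top
  -- For `β = 0` the nonvanishing of `|Δ(x)|^β` says nothing about `Δ(x)`; but then the slices are
  -- constant and `ν` is finite.
  rcases Nat.eq_zero_or_pos β with rfl | hβ
  · simpa using hupd 0
  have hdet : (Matrix.vandermonde x).det ≠ 0 := by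
    intro h
    simp [h, hβ.ne'] at hx
  have hdom : Integrable (fun t => (Fintype.card (Fin (n + 1)) : ℝ) ^ β *
      ∑ i, (|x i ^ (k : ℕ)| / |(Matrix.vandermonde x).det|) ^ β *
        |(Matrix.vandermonde (Function.update x i t)).det| ^ β) ν :=
    (integrable_finsetSum _ fun i _ => (hupd i).const_mul _).const_mul _
  refine hdom.mono' (by fun_prop) (Filter.Eventually.of_forall fun t => ?_)
  rw [Real.norm_of_nonneg (by positivity), pow_mul]
  simp only [← mul_pow]
  refine le_trans ?_ (sum_pow_le_card_pow_mul_sum_pow _ (fun i => by positivity) β)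
  refine pow_le_pow_left₀ (by positivity) ?_ β
  have h := pow_mul_det_vandermonde x t k
  rw [eq_comm, ← div_eq_iff hdet] at h
  rw [← abs_pow, ← h, abs_div, Finset.sum_congr rfl fun i _ => div_mul_eq_mul_div _ _ _,
    ← Finset.sum_div]
  gcongr
  refine (Finset.abs_sum_le_sum_abs _ _).trans (le_of_eq ?_)
  exact Finset.sum_congr rfl fun i _ => abs_mul _ _

theorem integrable_eval_of_natDegree_le {N β : ℕ} {ν : Measure ℝ} [SigmaFinite ν] (hN : 0 < N)
    (hpos : 0 < partitionFunction N β ν) (hfin : partitionFunction N β ν < ⊤)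
    {q : Polynomial ℝ} (hq : q.natDegree ≤ β * (N - 1)) : Integrable (fun t => q.eval t) ν := by
  -- The extreme moments suffice: `|t|^j ≤ 1 + |t|^((N-1)β)` for `j ≤ (N-1)β`.
  have h0 := integrable_abs_pow_mul hpos hfin ⟨0, hN⟩
  have h1 := integrable_abs_pow_mul hpos hfin ⟨N - 1, by omega⟩
  simp only [zero_mul, pow_zero] at h0
  simp only [Polynomial.eval_eq_sum_range]
  refine integrable_finsetSum _ fun j hj => Integrable.const_mul ?_ _
  refine (h0.add h1).mono' (by fun_prop) (Filter.Eventually.of_forall fun t => ?_)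
  rw [Finset.mem_range] at hj
  simp only [norm_pow, Real.norm_eq_abs, Pi.add_apply]
  rcases le_total |t| 1 with ht | ht
  · exact (pow_le_one₀ (abs_nonneg t) ht).trans (le_add_of_nonneg_right (by positivity))
  · refine (pow_le_pow_right₀ ht (n := (N - 1) * β) ?_).trans (le_add_of_nonneg_left zero_le_one)
    rw [mul_comm]; omega

/-- The Wronskian `det [ p_{t(i)}^{(ℓ)} / ℓ! ]` as a polynomial. -/
def wronskianPoly {n L : ℕ} (p : Fin n → Polynomial ℝ) (t : Fin L → Fin n) : Polynomial ℝ :=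
  Matrix.det (Matrix.of fun i l : Fin L => Polynomial.hasseDeriv l (p (t i)))

theorem eval_wronskianPoly {n L : ℕ} (p : Fin n → Polynomial ℝ) (t : Fin L → Fin n) (x : ℝ) :
    (wronskianPoly p t).eval x = wronskian p t x := by
  rw [wronskian_eq_det_jet, wronskianPoly, ← Polynomial.coe_evalRingHom, RingHom.map_det]
  congr 1
  ext i l
  simp [jet, Polynomial.taylor_coeff]

theorem orderEmbedding_fin_le {n L : ℕ} (t : Fin L ↪o Fin n) (l : Fin L) :
    (t l : ℕ) + L ≤ n + l := by
  have h := Finset.card_le_card_of_injOn (s := Finset.Ioi l) (t := Finset.Ioi (t l)) t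
    (fun i hi => by
      simp only [Finset.coe_Ioi, Set.mem_Ioi] at hi ⊢
      exact t.strictMono hi) t.injective.injOn
  simp only [Fin.card_Ioi] at h
  have := l.2
  have := (t l).2
  omega

/-- A nonzero term of the Leibniz expansion has degree at most `∑ t(l) - ∑ l`, and `t(l) ≤ NL - L +
l` because `t` is increasing. -/
theorem natDegree_wronskianPoly_le {N L : ℕ} (hN : 0 < N) (p : Fin (N * L) → Polynomial ℝ)
    (hp : IsCompleteMonic p) (t : Fin L ↪o Fin (N * L)) :
    (wronskianPoly p t).natDegree ≤ L ^ 2 * (N - 1) := by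
  rw [wronskianPoly, Matrix.det_apply]
  refine Polynomial.natDegree_sum_le_of_forall_le _ _ fun σ _ => ?_
  refine (Polynomial.natDegree_smul_le _ _).trans ?_
  simp only [Matrix.of_apply]
  -- A derivative of order exceeding the degree makes the whole term zero; otherwise no truncated
  -- subtraction interferes with the degree count.
  by_cases h : ∃ l : Fin L, (t (σ l) : ℕ) < l
  · obtain ⟨l, hl⟩ := h
    rw [Finset.prod_eq_zero (Finset.mem_univ l)]
    · simp
    · exact Polynomial.hasseDeriv_eq_zero_of_lt_natDegree _ _ (by rw [(hp _).2]; exact hl)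
  · push Not at h
    refine (Polynomial.natDegree_prod_le _ _).trans ?_
    have h1 : ∀ l : Fin L, (Polynomial.hasseDeriv l (p (t (σ l)))).natDegree + (l : ℕ) ≤
        t (σ l) := by
      intro l
      have := Polynomial.natDegree_hasseDeriv_le (p (t (σ l))) l
      rw [(hp _).2] at this
      have := h l
      omega
    have h2 := Finset.sum_le_sum fun l (_ : l ∈ Finset.univ) => h1 l
    have h3 := Finset.sum_le_sum fun l (_ : l ∈ Finset.univ) => orderEmbedding_fin_le t l
    rw [Finset.sum_add_distrib, Equiv.sum_comp σ (fun l => (t l : ℕ))] at h2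
    simp only [Finset.sum_add_distrib, Finset.sum_const, Finset.card_univ, Fintype.card_fin,
      smul_eq_mul] at h3
    obtain ⟨n, rfl⟩ : ∃ n, N = n + 1 := ⟨N - 1, by omega⟩
    have h4 : L * ((n + 1) * L) = L ^ 2 * n + L * L := by ring
    rw [h4] at h3
    simp only [Nat.add_sub_cancel]
    omega

theorem pairForm_eq_sum {n : ℕ} (L : ℕ) (p : Fin n → Polynomial ℝ) (k : ℝ → ℝ → ℝ) (x y : ℝ) :
    pairForm L p k x y = ∑ ts : (Fin L ↪o Fin n) × (Fin L ↪o Fin n),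
      (k x y * (wronskian p ts.1 x * wronskian p ts.2 y)) •
        wedge (basicForm ts.1) (basicForm ts.2) := by
  apply Subtype.ext
  simp only [pairForm, wedge, omega, Submodule.coe_smul, AddSubmonoidClass.coe_finsetSum,
    Fintype.sum_prod_type, Finset.sum_mul_sum, Finset.smul_sum, smul_mul_smul_comm, smul_smul]

theorem formIntegrable_pairForm {n L : ℕ} {p : Fin n → Polynomial ℝ} {k : ℝ → ℝ → ℝ}
    {ν : Measure ℝ} (h : ∀ t s : Fin L ↪o Fin n,
      Integrable (fun z : ℝ × ℝ => k z.1 z.2 * (wronskian p t z.1 * wronskian p s z.2))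
        (ν.prod ν)) :
    FormIntegrable (ν.prod ν) fun z => pairForm L p k z.1 z.2 := by
  simp only [pairForm_eq_sum]
  exact (HasWeakIntegral.of_sum (fun (ts : (Fin L ↪o Fin n) × (Fin L ↪o Fin n)) (z : ℝ × ℝ) =>
    k z.1 z.2 * (wronskian p ts.1 z.1 * wronskian p ts.2 z.2)) _
    fun ts => h ts.1 ts.2).formIntegrable

/-- The slack between `L^2 (N-1)` and `β(N-1)` pays for the factor `x^j`: none for `β = L^2`, and `j
≤ N-1` for `β = L^2 + 1`. -/
theorem integrable_wronskian_mul_pow {N L β j : ℕ} {ν : Measure ℝ} [SigmaFinite ν] (hN : 0 < N)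
    (hpos : 0 < partitionFunction N β ν) (hfin : partitionFunction N β ν < ⊤)
    {p : Fin (N * L) → Polynomial ℝ} (hp : IsCompleteMonic p)
    (hj : L ^ 2 * (N - 1) + j ≤ β * (N - 1)) (t : Fin L ↪o Fin (N * L)) :
    Integrable (fun x => x ^ j * wronskian p t x) ν := by
  have hdeg : (Polynomial.X ^ j * wronskianPoly p t).natDegree ≤ β * (N - 1) := by
    refine Polynomial.natDegree_mul_le.trans ?_
    rw [Polynomial.natDegree_X_pow]
    have := natDegree_wronskianPoly_le hN p hp t
    omega
  simpa [eval_wronskianPoly] using integrable_eval_of_natDegree_le hN hpos hfin hdeg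

theorem formIntegrable_omega {N L : ℕ} {ν : Measure ℝ} [SigmaFinite ν] (hN : 0 < N)
    (hpos : 0 < partitionFunction N (L ^ 2) ν) (hfin : partitionFunction N (L ^ 2) ν < ⊤)
    {p : Fin (N * L) → Polynomial ℝ} (hp : IsCompleteMonic p) :
    FormIntegrable ν (omega L p) := by
  have h := fun t => integrable_wronskian_mul_pow (j := 0) hN hpos hfin hp le_rfl t
  simp only [pow_zero, one_mul] at h
  exact (HasWeakIntegral.of_sum _ (fun t : Fin L ↪o Fin (N * L) => basicForm t) h).formIntegrable

theorem measurable_sign : Measurable Real.sign := by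
  unfold Real.sign
  exact Measurable.ite measurableSet_Iio measurable_const
    (Measurable.ite measurableSet_Ioi measurable_const measurable_const)

theorem formIntegrable_pairForm_sign {N L : ℕ} {ν : Measure ℝ} [SigmaFinite ν] (hN : 0 < N)
    (hpos : 0 < partitionFunction N (L ^ 2) ν) (hfin : partitionFunction N (L ^ 2) ν < ⊤)
    {p : Fin (N * L) → Polynomial ℝ} (hp : IsCompleteMonic p) :
    FormIntegrable (ν.prod ν) fun z => pairForm L p (fun x y => Real.sign (y - x)) z.1 z.2 := by
  have h := fun t => integrable_wronskian_mul_pow (j := 0) hN hpos hfin hp le_rfl t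
  simp only [pow_zero, one_mul] at h
  refine formIntegrable_pairForm fun t s => ((h t).mul_prod (h s)).bdd_mul (c := 1) ?_ ?_
  · exact (measurable_sign.comp (measurable_snd.sub measurable_fst)).aestronglyMeasurable
  · refine Filter.Eventually.of_forall fun z => ?_
    rcases Real.sign_apply_eq (z.2 - z.1) with h | h | h <;> simp [h]

/-- The sum is `y^M - x^M` times the geometric quotient `(y^M - x^M)/(y - x)`. On the diagonal both
sides vanish, so division by zero gives the intended value. The exponents stay below `2M`, and each
pair sums to `2M - 1`. -/
theorem sq_sub_pow_div_sub (M : ℕ) (x y : ℝ) :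
    (y ^ M - x ^ M) ^ 2 / (y - x) = ∑ a ∈ Finset.range M,
      (x ^ a * y ^ (2 * M - 1 - a) - x ^ (2 * M - 1 - a) * y ^ a) := by
  have h1 : ∑ a ∈ Finset.range M, (x ^ a * y ^ (2 * M - 1 - a) - x ^ (2 * M - 1 - a) * y ^ a) =
      (y ^ M - x ^ M) * ∑ a ∈ Finset.range M, x ^ a * y ^ (M - 1 - a) := by
    rw [sub_mul, Finset.mul_sum, Finset.mul_sum,
      ← Finset.sum_range_reflect (fun a => x ^ M * (x ^ a * y ^ (M - 1 - a))),
      ← Finset.sum_sub_distrib]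
    refine Finset.sum_congr rfl fun a ha => ?_
    rw [Finset.mem_range] at ha
    have e1 : 2 * M - 1 - a = M + (M - 1 - a) := by omega
    have e2 : M - 1 - (M - 1 - a) = a := by omega
    rw [e1, e2, pow_add, pow_add]
    ring
  rw [h1]
  rcases eq_or_ne x y with rfl | hxy
  · simp
  · rw [div_eq_iff (sub_ne_zero.2 hxy.symm), sq, mul_assoc]
    congr 1
    have := (Commute.all x y).geom_sum₂_mul M
    linear_combination this

theorem formIntegrable_pairForm_sq_sub {N M L : ℕ} {ν : Measure ℝ} [SigmaFinite ν] (hN : 0 < N)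
    (hNM : N = 2 * M)
    (hpos : 0 < partitionFunction N (L ^ 2 + 1) ν) (hfin : partitionFunction N (L ^ 2 + 1) ν < ⊤)
    {p : Fin (N * L) → Polynomial ℝ} (hp : IsCompleteMonic p) :
    FormIntegrable (ν.prod ν)
      fun z => pairForm L p (fun x y => (y ^ M - x ^ M) ^ 2 / (y - x)) z.1 z.2 := by
  have h : ∀ j, j ≤ N - 1 → ∀ t : Fin L ↪o Fin (N * L),
      Integrable (fun x => x ^ j * wronskian p t x) ν := fun j hj t =>
    integrable_wronskian_mul_pow (j := j) hN hpos hfin hp (by rw [add_mul, one_mul]; omega) t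
  refine formIntegrable_pairForm fun t s => ?_
  simp only [sq_sub_pow_div_sub, Finset.sum_mul]
  refine integrable_finsetSum _ fun a ha => ?_
  rw [Finset.mem_range] at ha
  have h1 := ((h a (by omega) t).mul_prod (h (2 * M - 1 - a) (by omega) s)).sub
    ((h (2 * M - 1 - a) (by omega) t).mul_prod (h a (by omega) s))
  refine h1.congr (Filter.Eventually.of_forall fun z => ?_)
  simp only [Pi.sub_apply]
  ring

/-! ### Powers of sums of decomposable 2-forms -/

section Commutation

variable {V : Type*} [AddCommGroup V] [Module ℝ V]

open ExteriorAlgebra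

theorem ι_mul_ι_eq_neg (u v : V) : ι ℝ u * ι ℝ v = -(ι ℝ v * ι ℝ u) :=
  eq_neg_of_add_eq_zero_left (ι_add_mul_swap u v)

theorem ι_mul_ιMulti (w : V) {n : ℕ} (v : Fin n → V) :
    ι ℝ w * ιMulti ℝ n v = (-1 : ℝ) ^ n • (ιMulti ℝ n v * ι ℝ w) := by
  induction n with
  | zero => simp
  | succ n ih =>
    rw [ιMulti_succ_apply, ← mul_assoc, ι_mul_ι_eq_neg, neg_mul, mul_assoc, ih, mul_smul_comm,
      pow_succ, mul_neg_one, neg_smul, mul_assoc]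

theorem commute_of_mem_even {n : ℕ} (hn : Even n) {a : ExteriorAlgebra ℝ V} (ha : a ∈ ⋀[ℝ]^n V)
    (b : ExteriorAlgebra ℝ V) : Commute a b := by
  rw [← ιMulti_span_fixedDegree] at ha
  induction b using ExteriorAlgebra.induction with
  | algebraMap r => exact (Algebra.commutes r a).symm
  | ι w =>
    induction ha using Submodule.span_induction with
    | mem a ha =>
      obtain ⟨v, rfl⟩ := ha
      have h := ι_mul_ιMulti w v
      rw [hn.neg_one_pow, one_smul] at h
      exact h.symm
    | zero => exact Commute.zero_left _
    | add a b _ _ ha hb => exact ha.add_left hb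
    | smul c a _ ha => exact ha.smul_left c
  | mul b c hb hc => exact hb.mul_right hc
  | add b c hb hc => exact hb.add_right hc

theorem ι_mul_ι_mem (u v : V) : ι ℝ u * ι ℝ v ∈ ⋀[ℝ]^2 V := by
  have h : ι ℝ u * ι ℝ v = ιMulti ℝ 2 ![u, v] := by
    simp [ιMulti_apply]
  rw [h]
  exact (exteriorPower.ιMulti ℝ 2 ![u, v]).2

theorem commute_ι_mul_ι (u v : V) (b : ExteriorAlgebra ℝ V) : Commute (ι ℝ u * ι ℝ v) b :=
  commute_of_mem_even even_two (ι_mul_ι_mem u v) b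

theorem ι_mul_ι_mul_self (u v : V) : (ι ℝ u * ι ℝ v) * (ι ℝ u * ι ℝ v) = 0 := by
  rw [← mul_assoc, (commute_ι_mul_ι u v (ι ℝ u)).eq, ← mul_assoc, ι_sq_zero, zero_mul, zero_mul]

/-- The exterior product `s_0 ∧ s_1 ∧ ⋯ ∧ s_{n-1}`. -/
def wedgeRange (s : ℕ → V) (n : ℕ) : ExteriorAlgebra ℝ V := ιMulti ℝ n fun i : Fin n => s i

theorem wedgeRange_succ (s : ℕ → V) (n : ℕ) :
    wedgeRange s (n + 1) = wedgeRange s n * ι ℝ (s n) := by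
  simp only [wedgeRange, ιMulti_apply]
  rw [List.ofFn_succ', List.concat_eq_append, List.prod_append, List.prod_singleton]
  rfl

theorem wedgeRange_succ_left (s : ℕ → V) (n : ℕ) :
    wedgeRange s (n + 1) = ι ℝ (s 0) * wedgeRange (fun i => s (i + 1)) n := by
  rw [wedgeRange, ιMulti_succ_apply]
  rfl

theorem wedgeRange_mul_ι (s : ℕ → V) {n j : ℕ} (hj : j < n) :
    wedgeRange s n * ι ℝ (s j) = 0 := by
  -- Overwriting `s_n` by `s_j` turns the product into a wedge of `n + 1` vectors with a repetition.
  have h := wedgeRange_succ (Function.update s n (s j)) n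
  rw [Function.update_self] at h
  have h' : wedgeRange (Function.update s n (s j)) n = wedgeRange s n := by
    unfold wedgeRange
    congr 1
    ext i
    rw [Function.update_of_ne i.2.ne]
  rw [← h', ← h]
  refine AlternatingMap.map_eq_zero_of_eq _ _ (i := ⟨j, by omega⟩) (j := Fin.last n) ?_ ?_
  · simp [Function.update_of_ne hj.ne]
  · simp [Fin.ext_iff, hj.ne]

theorem wedgeRange_mul_ι_mul_ι (s : ℕ → V) {n i : ℕ} (hi : i < n) (w : V) :
    wedgeRange s n * (ι ℝ (s i) * ι ℝ w) = 0 := by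
  rw [← mul_assoc, wedgeRange_mul_ι s hi, zero_mul]

/-- The binomial theorem cut off by `b * b = 0`; it peels a single 2-form off a sum. -/
theorem add_pow_succ_of_mul_self_eq_zero {A : Type*} [Ring A] {a b : A} (h : Commute a b)
    (hb : b * b = 0) (m : ℕ) : (a + b) ^ (m + 1) = a ^ (m + 1) + ((m : A) + 1) * (a ^ m * b) := by
  induction m with
  | zero => simp
  | succ m ih =>
    rw [pow_succ, ih, add_mul, mul_add, mul_add, mul_assoc _ _ a, mul_assoc _ _ b, mul_assoc _ b a,
      mul_assoc _ b b, hb, ← h.eq, ← mul_assoc _ a b, ← pow_succ, ← pow_succ]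
    push_cast
    noncomm_ring

/-- `∑_{j<n} s_j ∧ s_{j+1}`. -/
def pathForm (s : ℕ → V) (n : ℕ) : ExteriorAlgebra ℝ V :=
  ∑ j ∈ Finset.range n, ι ℝ (s j) * ι ℝ (s (j + 1))

theorem wedgeRange_mul_pathForm (s : ℕ → V) {n m : ℕ} (h : m ≤ n) :
    wedgeRange s n * pathForm s m = 0 := by
  rw [pathForm, Finset.mul_sum]
  refine Finset.sum_eq_zero fun j hj => wedgeRange_mul_ι_mul_ι s ?_ _
  rw [Finset.mem_range] at hj
  omega

theorem pathForm_succ_pow (s : ℕ → V) (n m : ℕ) : pathForm s (n + 1) ^ (m + 1) =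
    pathForm s n ^ (m + 1) + ((m : ExteriorAlgebra ℝ V) + 1) *
      (pathForm s n ^ m * (ι ℝ (s n) * ι ℝ (s (n + 1)))) := by
  rw [pathForm, Finset.sum_range_succ, ← pathForm]
  exact add_pow_succ_of_mul_self_eq_zero (commute_ι_mul_ι _ _ _).symm (ι_mul_ι_mul_self _ _) m

/-- A product of edges of a path survives only if the edges are disjoint. A path on `2M + 2`
vertices has exactly one perfect matching, a path on `2M + 1` vertices has no `M + 1` disjoint
edges, and multiplying by the last vertex leaves only the matching of the first `2M`. The three
claims are proved together because each induction step uses the previous ones. -/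
theorem pathForm_even_pow (s : ℕ → V) (M : ℕ) :
    pathForm s (2 * M) ^ M * ι ℝ (s (2 * M)) =
      (M.factorial : ExteriorAlgebra ℝ V) * wedgeRange s (2 * M + 1) ∧
    pathForm s (2 * M) ^ (M + 1) = 0 ∧
    pathForm s (2 * M + 1) ^ (M + 1) =
      ((M + 1).factorial : ExteriorAlgebra ℝ V) * wedgeRange s (2 * M + 2) := by
  have odd_of_even : ∀ M : ℕ, pathForm s (2 * M) ^ M * ι ℝ (s (2 * M)) =
      (M.factorial : ExteriorAlgebra ℝ V) * wedgeRange s (2 * M + 1) →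
      pathForm s (2 * M) ^ (M + 1) = 0 → pathForm s (2 * M + 1) ^ (M + 1) =
      ((M + 1).factorial : ExteriorAlgebra ℝ V) * wedgeRange s (2 * M + 2) := by
    intro M h1 h2
    rw [pathForm_succ_pow, h2, zero_add, ← mul_assoc (_ ^ M), h1, wedgeRange_succ s (2 * M + 1),
      Nat.factorial_succ]
    push_cast
    simp only [mul_assoc]
  induction M with
  | zero =>
    have h1 : pathForm s (2 * 0) ^ 0 * ι ℝ (s (2 * 0)) =
      (Nat.factorial 0 : ExteriorAlgebra ℝ V) * wedgeRange s (2 * 0 + 1) := by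
      simp [wedgeRange]
    have h2 : pathForm s (2 * 0) ^ (0 + 1) = 0 := by simp [pathForm]
    exact ⟨h1, h2, odd_of_even 0 h1 h2⟩
  | succ M ih =>
    obtain ⟨-, -, h⟩ := ih
    have h1 : pathForm s (2 * (M + 1)) ^ (M + 1) * ι ℝ (s (2 * (M + 1))) =
        ((M + 1).factorial : ExteriorAlgebra ℝ V) * wedgeRange s (2 * (M + 1) + 1) := by
      rw [show 2 * (M + 1) = 2 * M + 1 + 1 by ring, pathForm_succ_pow, add_mul, h,
        wedgeRange_succ s (2 * M + 1 + 1)]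
      simp only [mul_assoc, ι_sq_zero, mul_zero, add_zero]
    have h2 : pathForm s (2 * (M + 1)) ^ (M + 1 + 1) = 0 := by
      rw [show 2 * (M + 1) = 2 * M + 1 + 1 by ring, pathForm_succ_pow, pow_succ, h, mul_assoc,
        wedgeRange_mul_pathForm s (by omega), mul_assoc (M + 1).factorial.cast,
        wedgeRange_mul_ι_mul_ι s (by omega)]
      simp
    exact ⟨h1, h2, odd_of_even _ h1 h2⟩

/-- The pairs `{a, 2M-1-a}` form one perfect matching by nested arcs. Removing the outermost arc
gives the induction; `v_0` passes through the inner wedge without a sign, since that wedge has even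
degree. -/
theorem sum_nested_pow (v : ℕ → V) (M : ℕ) :
    (∑ a ∈ Finset.range M, ι ℝ (v a) * ι ℝ (v (2 * M - 1 - a))) ^ M =
      (M.factorial : ExteriorAlgebra ℝ V) * wedgeRange v (2 * M) := by
  induction M generalizing v with
  | zero => simp [wedgeRange]
  | succ M ih =>
    set w : ℕ → V := fun i => v (i + 1) with hw
    have h1 : ∑ a ∈ Finset.range (M + 1), ι ℝ (v a) * ι ℝ (v (2 * (M + 1) - 1 - a)) =
        ∑ a ∈ Finset.range M, ι ℝ (w a) * ι ℝ (w (2 * M - 1 - a)) +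
          ι ℝ (v 0) * ι ℝ (v (2 * M + 1)) := by
      rw [Finset.sum_range_succ']
      congr 1
      refine Finset.sum_congr rfl fun a ha => ?_
      rw [Finset.mem_range] at ha
      simp only [hw]
      congr 3
      omega
    have hmem : wedgeRange w (2 * M) ∈ ⋀[ℝ]^(2 * M) V := by
      rw [← ιMulti_span_fixedDegree]
      exact Submodule.subset_span ⟨_, rfl⟩
    rw [h1, add_pow_succ_of_mul_self_eq_zero (commute_ι_mul_ι _ _ _).symm (ι_mul_ι_mul_self _ _),
      pow_succ, ih w, mul_assoc, Finset.mul_sum, Finset.sum_eq_zero, mul_zero, zero_add]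
    · rw [show 2 * (M + 1) = 2 * M + 1 + 1 by ring, wedgeRange_succ, wedgeRange_succ_left, ← hw,
        Nat.factorial_succ, mul_assoc (M.factorial.cast), ← mul_assoc (wedgeRange w (2 * M)),
        (commute_of_mem_even (even_two_mul M) hmem (ι ℝ (v 0))).eq]
      push_cast
      simp only [mul_assoc]
    · intro a ha
      rw [Finset.mem_range] at ha
      exact wedgeRange_mul_ι_mul_ι w (by omega) _

/-- Each partial sum differs from the new vector by the previous partial sum, which is already a
factor. -/
theorem wedgeRange_partial_sums (u : ℕ → V) (n : ℕ) :
    wedgeRange (fun j => ∑ i ∈ Finset.range (j + 1), u i) n = wedgeRange u n := by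
  induction n with
  | zero => simp [wedgeRange]
  | succ n ih =>
    rw [wedgeRange_succ u, ← ih, wedgeRange_succ, Finset.sum_range_succ, map_add, mul_add]
    cases n with
    | zero => simp
    | succ n =>
      rw [wedgeRange_mul_ι (fun j => ∑ i ∈ Finset.range (j + 1), u i) (Nat.lt_succ_self n),
        zero_add]

/-- The form `∑_{i,j} sgn(j - i) u_i ∧ u_j` in terms of the partial sums of `u`. -/
theorem sum_sign_mul_eq_pathForm (u : ℕ → V) (n : ℕ) :
    ∑ i ∈ Finset.range (n + 1), ∑ j ∈ Finset.range (n + 1),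
      Real.sign ((j : ℝ) - i) • (ι ℝ (u i) * ι ℝ (u j)) =
      2 * pathForm (fun j => ∑ i ∈ Finset.range (j + 1), u i) n := by
  induction n with
  | zero => simp [pathForm]
  | succ n ih =>
    rw [Finset.sum_range_succ, Finset.sum_congr rfl fun i _ => Finset.sum_range_succ _ (n + 1),
      Finset.sum_add_distrib, ih, Finset.sum_range_succ _ (n + 1)]
    -- With `U_n = u_0 + ⋯ + u_n`, the new terms add up to `2 U_n ∧ u_(n+1)`, which is `2 U_n ∧
    -- U_(n+1)` because `U_n ∧ U_n = 0`.
    have hpath : pathForm (fun j => ∑ i ∈ Finset.range (j + 1), u i) (n + 1) =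
        pathForm (fun j => ∑ i ∈ Finset.range (j + 1), u i) n +
          ι ℝ (∑ i ∈ Finset.range (n + 1), u i) * ι ℝ (∑ i ∈ Finset.range (n + 1 + 1), u i) :=
      Finset.sum_range_succ _ n
    have h1 : ∀ i ∈ Finset.range (n + 1), Real.sign (((n + 1 : ℕ) : ℝ) - i) •
        (ι ℝ (u i) * ι ℝ (u (n + 1))) = ι ℝ (u i) * ι ℝ (u (n + 1)) := by
      intro i hi
      rw [Finset.mem_range] at hi
      rw [Real.sign_of_pos (sub_pos.2 (by exact_mod_cast hi)), one_smul]
    have h2 : ∀ i ∈ Finset.range (n + 1), Real.sign ((i : ℝ) - ((n + 1 : ℕ) : ℝ)) •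
        (ι ℝ (u (n + 1)) * ι ℝ (u i)) = ι ℝ (u i) * ι ℝ (u (n + 1)) := by
      intro i hi
      rw [Finset.mem_range] at hi
      rw [Real.sign_of_neg (sub_neg.2 (by exact_mod_cast hi)), neg_smul, one_smul,
        ← ι_mul_ι_eq_neg]
    rw [Finset.sum_congr rfl h1, Finset.sum_congr rfl h2, ← Finset.sum_mul, ← map_sum, sub_self,
      Real.sign_zero, zero_smul, add_zero, hpath, Finset.sum_range_succ u (n + 1), map_add, mul_add,
      mul_add, ι_sq_zero, zero_add]
    noncomm_ring

end Commutation

/-! ### Antisymmetrized weights as volume coefficients -/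

section Expansion

theorem sum_fin_succ_fun {A ι : Type*} [AddCommMonoid A] [Fintype ι] {n : ℕ} (w : (Fin (n + 1) → ι) → A) :
    ∑ f, w f = ∑ i, ∑ f : Fin n → ι, w (Fin.cons i f) := by
  rw [← (Fin.consEquiv fun _ : Fin (n + 1) => ι).sum_comp, Fintype.sum_prod_type]
  rfl

variable {A ι : Type*} [Ring A] [Algebra ℝ A] [Fintype ι]

/-- The discrete counterpart of `HasWeakIntegral.prod_pairs`, used to recognize an antisymmetrized
product weight as the power of a 2-form. -/
theorem pair_sum_pow (k : ι → ι → ℝ) (g : ι → A) (M : ℕ) :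
    (∑ i, ∑ j, k i j • (g i * g j)) ^ M =
      ∑ f : Fin (2 * M) → ι, pairWeight k M f • (List.ofFn fun i => g (f i)).prod := by
  induction M with
  | zero =>
    rw [pow_zero, Fintype.sum_eq_single (fun i => i.elim0)]
    · simp [pairWeight]
    · intro f hf
      exact absurd (funext fun i => i.elim0) hf
  | succ M ih =>
    have h := sum_fin_succ_fun (n := 2 * M + 1)
      fun f : Fin (2 * M + 1 + 1) → ι => pairWeight k (M + 1) f • (List.ofFn fun i => g (f i)).prod
    rw [pow_succ', ih]
    refine Eq.trans ?_ h.symm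
    simp only [sum_fin_succ_fun, Finset.sum_mul]
    refine Finset.sum_congr rfl fun i _ => ?_
    refine Finset.sum_congr rfl fun j _ => ?_
    rw [Finset.mul_sum]
    refine Finset.sum_congr rfl fun f _ => ?_
    rw [List.ofFn_succ, List.ofFn_succ, List.prod_cons, List.prod_cons, smul_mul_smul_comm,
      mul_assoc]
    rfl

theorem sum_mul_pair_sum_pow (k : ι → ι → ℝ) (g : ι → A) (M : ℕ) :
    (∑ i, g i) * (∑ i, ∑ j, k i j • (g i * g j)) ^ M =
      ∑ f : Fin (2 * M + 1) → ι,
        pairWeight k M (Fin.tail f) • (List.ofFn fun i => g (f i)).prod := by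
  rw [pair_sum_pow, sum_fin_succ_fun, Finset.sum_mul_sum]
  refine Finset.sum_congr rfl fun i _ => Finset.sum_congr rfl fun f _ => ?_
  rw [List.ofFn_succ, List.prod_cons, mul_smul_comm]
  rfl

end Expansion

theorem pairWeight_comp {X Y : Type*} (k : Y → Y → ℝ) (x : X → Y) (M : ℕ) (f : Fin (2 * M) → X) :
    pairWeight k M (fun i => x (f i)) = pairWeight (fun i j => k (x i) (x j)) M f := by
  induction M with
  | zero => rfl
  | succ M ih =>
    rw [pairWeight, pairWeight, ← ih]
    rfl

/-- Words with a repeated letter vanish; a permutation contributes its sign. -/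
theorem volCoeff_sum_smul_prod {N : ℕ} (w : (Fin N → Fin N) → ℝ) :
    volCoeff N (∑ f, w f • (List.ofFn fun i => ExteriorAlgebra.ι ℝ (e (f i))).prod) =
      ∑ σ : Equiv.Perm (Fin N), (Equiv.Perm.sign σ : ℝ) * w σ := by
  have hσ : ∀ σ : Equiv.Perm (Fin N),
      volCoeff N (ExteriorAlgebra.ιMulti ℝ N fun i => e (σ i)) = Equiv.Perm.sign σ := by
    intro σ
    have := (ExteriorAlgebra.ιMulti ℝ N).map_perm (fun i : Fin N => (e i : Fin N → ℝ)) σ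
    simp only [Function.comp_def] at this
    rw [this, Units.smul_def, map_zsmul]
    change _ • volCoeff N (volForm N) = _
    rw [volCoeff_volForm]
    simp
  simp only [map_sum, map_smul, smul_eq_mul, ← ExteriorAlgebra.ιMulti_apply]
  classical
  rw [← Finset.sum_subset (Finset.subset_univ
      (Finset.univ.image fun σ : Equiv.Perm (Fin N) => (σ : Fin N → Fin N))),
    Finset.sum_image fun a _ b _ h => Equiv.coe_fn_injective h]
  · exact Finset.sum_congr rfl fun σ _ => by rw [hσ, mul_comm]
  · intro f _ hf
    rw [ExteriorAlgebra.ιMulti_eq_zero_of_not_inj, map_zero, mul_zero]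
    intro hinj
    apply hf
    have hf' : Function.Injective f := fun i j hij => hinj (by simp [hij])
    exact Finset.mem_image.2 ⟨Equiv.ofBijective f (Finite.injective_iff_bijective.1 hf'),
      Finset.mem_univ _, rfl⟩

theorem det_vandermonde_perm {N : ℕ} (x : Fin N → ℝ) (σ : Equiv.Perm (Fin N)) :
    (Matrix.vandermonde fun i => x (σ i)).det =
      (Equiv.Perm.sign σ : ℝ) * (Matrix.vandermonde x).det := by
  rw [← Matrix.det_permute σ (Matrix.vandermonde x)]
  rfl

/-- The signed sum of `w` over the rearrangements of `x`. -/
def antisymmetrization {N : ℕ} (w : (Fin N → ℝ) → ℝ) (x : Fin N → ℝ) : ℝ :=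
  ∑ σ : Equiv.Perm (Fin N), (Equiv.Perm.sign σ : ℝ) * w fun i => x (σ i)

theorem sign_mul_sign_self {N : ℕ} (σ : Equiv.Perm (Fin N)) :
    (Equiv.Perm.sign σ : ℝ) * (Equiv.Perm.sign σ : ℝ) = 1 := by
  rw [← Int.cast_mul, ← Units.val_mul, Int.units_mul_self]
  simp

theorem antisymmetrization_perm {N : ℕ} (w : (Fin N → ℝ) → ℝ) (x : Fin N → ℝ)
    (σ : Equiv.Perm (Fin N)) :
    antisymmetrization w (fun i => x (σ i)) =
      (Equiv.Perm.sign σ : ℝ) * antisymmetrization w x := by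
  unfold antisymmetrization
  rw [← Equiv.sum_comp (Equiv.mulLeft σ) fun τ => (Equiv.Perm.sign τ : ℝ) * w fun i => x (τ i),
    Finset.mul_sum]
  refine Finset.sum_congr rfl fun τ _ => ?_
  simp only [Equiv.coe_mulLeft, Equiv.Perm.sign_mul, Units.val_mul, Int.cast_mul,
    Equiv.Perm.coe_mul, Function.comp_apply]
  rw [← mul_assoc, ← mul_assoc, sign_mul_sign_self, one_mul]

theorem sign_det_vandermonde_of_strictMono {N : ℕ} {x : Fin N → ℝ} (hx : StrictMono x) :
    Real.sign (Matrix.vandermonde x).det = 1 := by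
  rw [Matrix.det_vandermonde]
  refine Real.sign_of_pos (Finset.prod_pos fun i _ => Finset.prod_pos fun j hj => ?_)
  exact sub_pos.2 (hx (Finset.mem_Ioi.1 hj))

/-- An antisymmetrization that is constant on increasing sequences is a multiple of the sign of the
Vandermonde determinant. -/
theorem antisymmetrization_eq_of_strictMono {N : ℕ} {w : (Fin N → ℝ) → ℝ} {c : ℝ}
    (h : ∀ x, StrictMono x → antisymmetrization w x = c) {x : Fin N → ℝ}
    (hx : Function.Injective x) :
    antisymmetrization w x = c * Real.sign (Matrix.vandermonde x).det := by
  -- Sorting `x` changes the antisymmetrization and the Vandermonde determinant by the same sign.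
  have hmono : StrictMono fun i => x (Tuple.sort x i) :=
    (Tuple.monotone_sort x).strictMono_of_injective (hx.comp (Tuple.sort x).injective)
  have h1 := h _ hmono
  have h2 := sign_det_vandermonde_of_strictMono hmono
  rw [antisymmetrization_perm] at h1
  rw [det_vandermonde_perm] at h2
  rcases Int.units_eq_one_or (Equiv.Perm.sign (Tuple.sort x)) with hs | hs
  · simp only [hs, Units.val_one, Int.cast_one, one_mul] at h1 h2
    rw [h1, h2, mul_one]
  · simp only [hs, Units.val_neg, Units.val_one, Int.cast_neg, Int.cast_one, neg_mul, one_mul,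
      Real.sign_neg] at h1 h2
    linear_combination -h1 + c * h2

theorem antisymmetrization_eq_volCoeff {N : ℕ} (w : (Fin N → ℝ) → ℝ) (x : Fin N → ℝ) :
    antisymmetrization w x = volCoeff N (∑ f : Fin N → Fin N, (w fun i => x (f i)) •
      (List.ofFn fun i => ExteriorAlgebra.ι ℝ (e (f i))).prod) := by
  rw [volCoeff_sum_smul_prod]
  rfl

/-- The basis vectors of `ℝ^N`, continued by zero. -/
def eNat (N i : ℕ) : Fin N → ℝ := if h : i < N then e ⟨i, h⟩ else 0

theorem eNat_val {N : ℕ} (i : Fin N) : eNat N i = e i := by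
  simp [eNat]

theorem sign_sub_of_strictMono {N : ℕ} {x : Fin N → ℝ} (hx : StrictMono x) (i j : Fin N) :
    Real.sign (x j - x i) = Real.sign (((j : ℕ) : ℝ) - ((i : ℕ) : ℝ)) := by
  rcases lt_trichotomy i j with h | h | h
  · rw [Real.sign_of_pos (sub_pos.2 (hx h)), Real.sign_of_pos (sub_pos.2 (by exact_mod_cast h))]
  · simp [h]
  · rw [Real.sign_of_neg (sub_neg.2 (hx h)), Real.sign_of_neg (sub_neg.2 (by exact_mod_cast h))]

theorem sum_sign_sub_of_strictMono {n : ℕ} {x : Fin (n + 1) → ℝ} (hx : StrictMono x) :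
    ∑ i, ∑ j, Real.sign (x j - x i) • (ExteriorAlgebra.ι ℝ (e i) * ExteriorAlgebra.ι ℝ (e j)) =
      2 * pathForm (fun j => ∑ i ∈ Finset.range (j + 1), eNat (n + 1) i) n := by
  rw [← sum_sign_mul_eq_pathForm, Finset.sum_range]
  refine Finset.sum_congr rfl fun i _ => ?_
  rw [Finset.sum_range]
  refine Finset.sum_congr rfl fun j _ => ?_
  rw [sign_sub_of_strictMono hx, eNat_val, eNat_val]

theorem volCoeff_wedgeRange_eNat (N : ℕ) : volCoeff N (wedgeRange (eNat N) N) = 1 := by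
  simp only [wedgeRange, eNat_val]
  exact volCoeff_volForm N

theorem volCoeff_natCast_mul {N : ℕ} (m : ℕ) (a : ExteriorAlgebra ℝ (Fin N → ℝ)) :
    volCoeff N ((m : ExteriorAlgebra ℝ (Fin N → ℝ)) * a) = m * volCoeff N a := by
  rw [← nsmul_eq_mul, map_nsmul, nsmul_eq_mul]

theorem two_mul_pow {A : Type*} [Ring A] (a : A) (M : ℕ) :
    (2 * a) ^ M = ((2 ^ M : ℕ) : A) * a ^ M := by
  have h := (Nat.cast_commute 2 a).mul_pow M
  push_cast at h ⊢
  exact h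

/-- On increasing sequences the kernel is `sgn(j - i)`, independent of `x`, so the 2-form is twice
the path form of the partial sums of the `e_i`, and its power is explicit. -/
theorem antisymmetrization_sign_even (M : ℕ) {x : Fin (2 * M) → ℝ} (hx : Function.Injective x) :
    antisymmetrization (pairWeight (fun s t => Real.sign (t - s)) M) x =
      (2 ^ M * M.factorial) * Real.sign (Matrix.vandermonde x).det := by
  refine antisymmetrization_eq_of_strictMono (fun x hx => ?_) hx
  rw [antisymmetrization_eq_volCoeff]
  simp only [pairWeight_comp]
  rw [← pair_sum_pow (fun i j => Real.sign (x j - x i)) (fun i => ExteriorAlgebra.ι ℝ (e i))]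
  -- The path on `2M + 2` vertices has `2M + 1` edges, so the empty case has to be split off.
  cases M with
  | zero => simpa [volForm, ExteriorAlgebra.ιMulti_apply] using volCoeff_volForm (2 * 0)
  | succ M =>
    have h := sum_sign_sub_of_strictMono (n := 2 * M + 1) hx
    refine (congrArg (fun a => volCoeff (2 * (M + 1)) (a ^ (M + 1))) h).trans ?_
    rw [two_mul_pow, (pathForm_even_pow _ M).2.2, wedgeRange_partial_sums, volCoeff_natCast_mul,
      volCoeff_natCast_mul]
    refine (congrArg (fun c => _ * (_ * c)) (volCoeff_wedgeRange_eNat _)).trans ?_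
    push_cast
    ring

/-- The unpaired variable contributes `∑ e_i`, which is the last partial sum, that is, the last
vertex of the path; the first claim of `pathForm_even_pow` applies. -/
theorem antisymmetrization_sign_odd (M : ℕ) {x : Fin (2 * M + 1) → ℝ}
    (hx : Function.Injective x) :
    antisymmetrization (fun y => pairWeight (fun s t => Real.sign (t - s)) M (Fin.tail y)) x =
      (2 ^ M * M.factorial) * Real.sign (Matrix.vandermonde x).det := by
  refine antisymmetrization_eq_of_strictMono (fun x hx => ?_) hx
  rw [antisymmetrization_eq_volCoeff]
  have h1 : ∀ f : Fin (2 * M + 1) → Fin (2 * M + 1),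
      pairWeight (fun s t => Real.sign (t - s)) M (Fin.tail fun i => x (f i)) =
        pairWeight (fun i j => Real.sign (x j - x i)) M (Fin.tail f) := fun f =>
    pairWeight_comp _ x M (Fin.tail f)
  simp only [h1]
  rw [← sum_mul_pair_sum_pow (fun i j => Real.sign (x j - x i))
    (fun i => ExteriorAlgebra.ι ℝ (e i)), sum_sign_sub_of_strictMono hx, two_mul_pow]
  have h2 : ∑ i : Fin (2 * M + 1), ExteriorAlgebra.ι ℝ (e i : Fin (2 * M + 1) → ℝ) =
      ExteriorAlgebra.ι ℝ (∑ i ∈ Finset.range (2 * M + 1), eNat (2 * M + 1) i) := by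
    rw [Finset.sum_range, map_sum]
    simp only [eNat_val]
  have hcomm : ∀ a : ExteriorAlgebra ℝ (Fin (2 * M + 1) → ℝ),
      Commute a (pathForm (fun j => ∑ i ∈ Finset.range (j + 1), eNat (2 * M + 1) i) (2 * M) ^ M) :=
    fun a => Commute.pow_right (Commute.sum_right _ _ _ fun j _ => (commute_ι_mul_ι _ _ a).symm) M
  rw [h2, ← mul_assoc, (Nat.cast_commute (2 ^ M) _).eq.symm, mul_assoc, (hcomm _).eq,
    (pathForm_even_pow _ M).1, wedgeRange_partial_sums, volCoeff_natCast_mul,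
    volCoeff_natCast_mul, volCoeff_wedgeRange_eNat]
  push_cast
  ring

/-- In terms of `u_a = ∑ x_i^a e_i` the 2-form is `2 ∑ u_a ∧ u_(2M-1-a)`. Its power is a multiple of
`u_0 ∧ ⋯ ∧ u_(2M-1)`, whose volume coefficient is the Vandermonde determinant itself, with no
sorting of the points. -/
theorem antisymmetrization_sq_sub (M : ℕ) (x : Fin (2 * M) → ℝ) :
    antisymmetrization (pairWeight (fun s t => (t ^ M - s ^ M) ^ 2 / (t - s)) M) x =
      (2 ^ M * M.factorial) * (Matrix.vandermonde x).det := by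
  rw [antisymmetrization_eq_volCoeff]
  simp only [pairWeight_comp]
  rw [← pair_sum_pow (fun i j => (x j ^ M - x i ^ M) ^ 2 / (x j - x i))
    (fun i => ExteriorAlgebra.ι ℝ (e i))]
  set u : ℕ → Fin (2 * M) → ℝ := fun a => ∑ i, x i ^ a • e i with hu
  have hprod : ∀ a b, ExteriorAlgebra.ι ℝ (u a) * ExteriorAlgebra.ι ℝ (u b) =
      ∑ i, ∑ j, (x i ^ a * x j ^ b) • (ExteriorAlgebra.ι ℝ (e i) * ExteriorAlgebra.ι ℝ (e j)) := by
    intro a b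
    simp only [hu, map_sum, map_smul, Finset.sum_mul_sum, smul_mul_smul_comm]
  have h1 : ∑ i, ∑ j, ((x j ^ M - x i ^ M) ^ 2 / (x j - x i)) •
      (ExteriorAlgebra.ι ℝ (e i) * ExteriorAlgebra.ι ℝ (e j)) =
      2 * ∑ a ∈ Finset.range M,
        ExteriorAlgebra.ι ℝ (u a) * ExteriorAlgebra.ι ℝ (u (2 * M - 1 - a)) := by
    have h2 : ∀ a b, 2 * (ExteriorAlgebra.ι ℝ (u a) * ExteriorAlgebra.ι ℝ (u b)) =
        ExteriorAlgebra.ι ℝ (u a) * ExteriorAlgebra.ι ℝ (u b) -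
          ExteriorAlgebra.ι ℝ (u b) * ExteriorAlgebra.ι ℝ (u a) := by
      intro a b
      rw [ι_mul_ι_eq_neg (u b), sub_neg_eq_add]
      exact two_mul _
    rw [Finset.mul_sum, Finset.sum_congr rfl fun a _ => h2 a _]
    simp only [hprod, ← Finset.sum_sub_distrib, ← sub_smul, sq_sub_pow_div_sub, Finset.sum_smul]
    symm
    rw [Finset.sum_comm]
    refine Finset.sum_congr rfl fun i _ => ?_
    rw [Finset.sum_comm]
  rw [h1, two_mul_pow, sum_nested_pow, volCoeff_natCast_mul, volCoeff_natCast_mul, wedgeRange,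
    volCoeff_ιMulti, ← Matrix.det_transpose]
  push_cast
  rw [mul_assoc]
  congr 3
  ext i a
  simp [hu, e, Finset.sum_apply, Matrix.vandermonde_apply, Pi.single_apply]

/-! ### Symmetrization of integrals against Vandermonde powers -/

theorem toReal_partitionFunction (N β : ℕ) (ν : Measure ℝ) [SigmaFinite ν] :
    (partitionFunction N β ν).toReal = (N.factorial : ℝ)⁻¹ *
      ∫ x : Fin N → ℝ, |(Matrix.vandermonde x).det| ^ β ∂(Measure.pi fun _ => ν) := by
  simp only [partitionFunction, prod_abs_sub_pow]
  rw [ENNReal.toReal_mul, ENNReal.toReal_inv, ENNReal.toReal_natCast,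
    integral_eq_lintegral_of_nonneg_ae (Filter.Eventually.of_forall fun x => by positivity)
      (continuous_abs_det_vandermonde_pow β).aestronglyMeasurable]

theorem measurePreserving_comp_perm {N : ℕ} (ν : Measure ℝ) [SigmaFinite ν]
    (σ : Equiv.Perm (Fin N)) :
    ∃ E : (Fin N → ℝ) ≃ᵐ (Fin N → ℝ), (∀ x, E x = fun i => x (σ i)) ∧
      MeasurePreserving E (Measure.pi fun _ => ν) (Measure.pi fun _ => ν) := by
  refine ⟨MeasurableEquiv.piCongrLeft (fun _ => ℝ) σ.symm, fun x => ?_,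
    measurePreserving_piCongrLeft (fun _ : Fin N => ν) σ.symm⟩
  ext i
  have := MeasurableEquiv.piCongrLeft_apply_apply (β := fun _ => ℝ) σ.symm x (σ i)
  simpa using this

theorem sign_pow_odd {N q : ℕ} (hq : Odd q) (σ : Equiv.Perm (Fin N)) :
    (Equiv.Perm.sign σ : ℝ) ^ q = Equiv.Perm.sign σ := by
  rcases Int.units_eq_one_or (Equiv.Perm.sign σ) with h | h <;> simp [h, hq.neg_one_pow]

/-- Integration against an odd power of the Vandermonde determinant only sees the
antisymmetrization of the weight. -/
theorem factorial_mul_integral_mul_det_pow {N q : ℕ} (hq : Odd q) (ν : Measure ℝ) [SigmaFinite ν]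
    {w : (Fin N → ℝ) → ℝ}
    (hw : Integrable (fun x => w x * (Matrix.vandermonde x).det ^ q) (Measure.pi fun _ => ν)) :
    (N.factorial : ℝ) * ∫ x, w x * (Matrix.vandermonde x).det ^ q ∂(Measure.pi fun _ => ν) =
      ∫ x, antisymmetrization w x * (Matrix.vandermonde x).det ^ q ∂(Measure.pi fun _ => ν) := by
  have key : ∀ σ : Equiv.Perm (Fin N),
      Integrable (fun x : Fin N → ℝ => (Equiv.Perm.sign σ : ℝ) * w (fun i => x (σ i)) *
        (Matrix.vandermonde x).det ^ q) (Measure.pi fun _ => ν) ∧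
      ∫ x : Fin N → ℝ, (Equiv.Perm.sign σ : ℝ) * w (fun i => x (σ i)) *
        (Matrix.vandermonde x).det ^ q ∂(Measure.pi fun _ => ν) =
      ∫ x, w x * (Matrix.vandermonde x).det ^ q ∂(Measure.pi fun _ => ν) := by
    intro σ
    obtain ⟨E, hE, hmp⟩ := measurePreserving_comp_perm ν σ
    -- An odd power of the determinant changes by `sign σ`, which absorbs the sign in front of the
    -- permuted weight.
    have h1 : ∀ x : Fin N → ℝ, (Equiv.Perm.sign σ : ℝ) * w (fun i => x (σ i)) *
        (Matrix.vandermonde x).det ^ q = w (E x) * (Matrix.vandermonde (E x)).det ^ q := by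
      intro x
      rw [hE, det_vandermonde_perm, mul_pow, sign_pow_odd hq]
      ring
    simp only [h1]
    exact ⟨(hmp.integrable_comp_emb E.measurableEmbedding).2 hw,
      hmp.integral_comp E.measurableEmbedding fun x => w x * (Matrix.vandermonde x).det ^ q⟩
  simp only [antisymmetrization, Finset.sum_mul]
  rw [integral_finsetSum _ fun σ _ => (key σ).1, Finset.sum_congr rfl fun σ _ => (key σ).2]
  simp [Fintype.card_perm]

theorem integral_mul_det_pow_eq {N q β : ℕ} (hq : Odd q) (ν : Measure ℝ) [SigmaFinite ν]
    {w : (Fin N → ℝ) → ℝ} {c : ℝ}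
    (hw : Integrable (fun x => w x * (Matrix.vandermonde x).det ^ q) (Measure.pi fun _ => ν))
    (hc : ∀ x, antisymmetrization w x * (Matrix.vandermonde x).det ^ q =
      c * |(Matrix.vandermonde x).det| ^ β) :
    ∫ x, w x * (Matrix.vandermonde x).det ^ q ∂(Measure.pi fun _ => ν) =
      c * (partitionFunction N β ν).toReal := by
  have h := factorial_mul_integral_mul_det_pow hq ν hw
  simp only [hc] at h
  rw [integral_const_mul] at h
  have hN : (N.factorial : ℝ) ≠ 0 := by exact_mod_cast N.factorial_ne_zero
  rw [toReal_partitionFunction]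
  field_simp
  linear_combination h

theorem sign_mul_pow_odd {q : ℕ} (hq : Odd q) (d : ℝ) : Real.sign d * d ^ q = |d| ^ q := by
  rcases lt_trichotomy d 0 with h | h | h
  · rw [Real.sign_of_neg h, abs_of_neg h, hq.neg_pow, neg_one_mul]
  · simp [h, hq.pos.ne']
  · rw [Real.sign_of_pos h, abs_of_pos h, one_mul]

/-- Where two points coincide the Vandermonde factor is zero, so the values of the weight there are
irrelevant even if `ν` has atoms. -/
theorem antisymmetrization_mul_pow_of_injective {N q : ℕ} (hq : Odd q) {w : (Fin N → ℝ) → ℝ}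
    {c : ℝ} (h : ∀ x, Function.Injective x →
      antisymmetrization w x = c * Real.sign (Matrix.vandermonde x).det) (x : Fin N → ℝ) :
    antisymmetrization w x * (Matrix.vandermonde x).det ^ q =
      c * |(Matrix.vandermonde x).det| ^ q := by
  by_cases hx : Function.Injective x
  · rw [h x hx, mul_assoc, sign_mul_pow_odd hq]
  · rw [← Matrix.det_vandermonde_ne_zero_iff, not_not] at hx
    simp [hx, hq.pos.ne']

/-! ### Volume coefficients of powers of the integrated forms -/

theorem volCoeff_prod_omega_eq_det_pow {N L : ℕ} (p : Fin (N * L) → Polynomial ℝ)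
    (hp : IsCompleteMonic p) (x : Fin N → ℝ) :
    volCoeff (N * L) (List.ofFn fun m =>
      (omega L p (x m) : ExteriorAlgebra ℝ (Fin (N * L) → ℝ))).prod =
      (Matrix.vandermonde x).det ^ L ^ 2 := by
  rw [volCoeff_prod_omega p hp, Matrix.det_vandermonde]
  simp only [Finset.prod_pow]

theorem hyperpfaffian_formIntegral_omega {N L : ℕ} (hL : 0 < L) (hβ : Even (L ^ 2)) {ν : Measure ℝ}
    [SigmaFinite ν] {p : Fin (N * L) → Polynomial ℝ} (hp : IsCompleteMonic p)
    (hint : FormIntegrable ν (omega L p)) :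
    hyperpfaffian (formIntegral ν (omega L p)) = (partitionFunction N (L ^ 2) ν).toReal := by
  have h := ((hint.hasWeakIntegral.map (formSubtype (N * L) L)).prod_pi N (volCoeff (N * L))).2
  change ∫ x : Fin N → ℝ, volCoeff (N * L) (List.ofFn fun m =>
    (omega L p (x m) : ExteriorAlgebra ℝ (Fin (N * L) → ℝ))).prod ∂_ = _ at h
  simp only [volCoeff_prod_omega_eq_det_pow p hp] at h
  rw [hyperpfaffian, Nat.mul_div_cancel _ hL, map_smul, smul_eq_mul, toReal_partitionFunction]
  simp only [hβ.pow_abs, h]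
  rfl

/-- The factor ½ in each double form cancels the `2^M` of the antisymmetrized weight. -/
theorem volCoeff_doubleForm_pow {M L β : ℕ} (hq : Odd (L ^ 2)) {ν : Measure ℝ} [SigmaFinite ν]
    {p : Fin (2 * M * L) → Polynomial ℝ} (hp : IsCompleteMonic p) {k : ℝ → ℝ → ℝ}
    (hint : FormIntegrable (ν.prod ν) fun z => pairForm L p k z.1 z.2)
    (hk : ∀ x : Fin (2 * M) → ℝ, antisymmetrization (pairWeight k M) x *
      (Matrix.vandermonde x).det ^ L ^ 2 =
        (2 ^ M * M.factorial) * |(Matrix.vandermonde x).det| ^ β) :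
    volCoeff (2 * M * L)
        ((doubleForm L p k ν : ExteriorAlgebra ℝ (Fin (2 * M * L) → ℝ)) ^ M) =
      M.factorial * (partitionFunction (2 * M) β ν).toReal := by
  have h := HasWeakIntegral.prod_pairs (k := k)
    (F := fun x => (omega L p x : ExteriorAlgebra ℝ (Fin (2 * M * L) → ℝ)))
    (hasWeakIntegral_doubleForm hint) M (volCoeff (2 * M * L))
  simp only [map_smul, smul_eq_mul, volCoeff_prod_omega_eq_det_pow p hp, smul_pow] at h
  have h1 := integral_mul_det_pow_eq hq ν h.1 hk
  rw [h.2] at h1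
  have h2 : (2 : ℝ) ^ M ≠ 0 := by positivity
  apply mul_left_cancel₀ h2
  linear_combination h1

theorem hyperpfaffian_doubleForm {M L β : ℕ} (hL : 0 < L) (hq : Odd (L ^ 2)) {ν : Measure ℝ}
    [SigmaFinite ν] {p : Fin (2 * M * L) → Polynomial ℝ} (hp : IsCompleteMonic p)
    {k : ℝ → ℝ → ℝ} (hint : FormIntegrable (ν.prod ν) fun z => pairForm L p k z.1 z.2)
    (hk : ∀ x : Fin (2 * M) → ℝ, antisymmetrization (pairWeight k M) x *
      (Matrix.vandermonde x).det ^ L ^ 2 =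
        (2 ^ M * M.factorial) * |(Matrix.vandermonde x).det| ^ β) :
    hyperpfaffian (doubleForm L p k ν) = (partitionFunction (2 * M) β ν).toReal := by
  have hM : 2 * M * L / (L + L) = M := by
    rw [show 2 * M * L = M * (L + L) by ring, Nat.mul_div_cancel _ (by omega)]
  have hfac : (M.factorial : ℝ) ≠ 0 := by exact_mod_cast M.factorial_ne_zero
  rw [hyperpfaffian, hM, map_smul, smul_eq_mul, volCoeff_doubleForm_pow hq hp hint hk,
    inv_mul_cancel_left₀ hfac]

/-- The analogue for an odd number of variables: coordinate `0` carries the single `ω`, the others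
are paired. -/
theorem volCoeff_omega_mul_doubleForm_pow {M L : ℕ} (hq : Odd (L ^ 2)) {ν : Measure ℝ}
    [SigmaFinite ν] {p : Fin ((2 * M + 1) * L) → Polynomial ℝ} (hp : IsCompleteMonic p)
    (hω : FormIntegrable ν (omega L p))
    (hint : FormIntegrable (ν.prod ν)
      fun z => pairForm L p (fun x y => Real.sign (y - x)) z.1 z.2) :
    volCoeff ((2 * M + 1) * L)
        ((formIntegral ν (omega L p) : ExteriorAlgebra ℝ (Fin ((2 * M + 1) * L) → ℝ)) *
          (doubleForm L p (fun x y => Real.sign (y - x)) ν :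
            ExteriorAlgebra ℝ (Fin ((2 * M + 1) * L) → ℝ)) ^ M) =
      M.factorial * (partitionFunction (2 * M + 1) (L ^ 2) ν).toReal := by
  have h := ((hω.hasWeakIntegral.map (formSubtype _ L)).mul
    (HasWeakIntegral.prod_pairs (k := fun x y => Real.sign (y - x))
      (F := fun x => (omega L p x : ExteriorAlgebra ℝ (Fin ((2 * M + 1) * L) → ℝ)))
      (hasWeakIntegral_doubleForm hint) M)).pi_succ (volCoeff ((2 * M + 1) * L))
  have hprod : ∀ x : Fin (2 * M + 1) → ℝ, volCoeff ((2 * M + 1) * L)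
      (formSubtype _ L (omega L p (x 0)) *
        (pairWeight (fun x y => Real.sign (y - x)) M (Fin.tail x) • (List.ofFn fun i =>
          (omega L p (Fin.tail x i) : ExteriorAlgebra ℝ (Fin ((2 * M + 1) * L) → ℝ))).prod)) =
      pairWeight (fun x y => Real.sign (y - x)) M (Fin.tail x) *
        (Matrix.vandermonde x).det ^ L ^ 2 := by
    intro x
    rw [← volCoeff_prod_omega_eq_det_pow p hp, mul_smul_comm, map_smul, smul_eq_mul,
      List.ofFn_succ, List.prod_cons]
    rfl
  simp only [hprod] at h
  simp only [smul_pow, mul_smul_comm, map_smul, smul_eq_mul] at h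
  have h1 := integral_mul_det_pow_eq (β := L ^ 2) hq ν h.1
    (antisymmetrization_mul_pow_of_injective hq fun x hx => antisymmetrization_sign_odd M hx)
  rw [h.2] at h1
  have h2 : (2 : ℝ) ^ M ≠ 0 := by positivity
  apply mul_left_cancel₀ h2
  refine Eq.trans ?_ (h1.trans (by ring))
  rfl

/-! ### Odd `N`: bordering by `ε'` -/

theorem eq_zero_of_mem_of_lt {n m : ℕ} (h : n < m) {a : ExteriorAlgebra ℝ (Fin n → ℝ)}
    (ha : a ∈ ⋀[ℝ]^m (Fin n → ℝ)) : a = 0 := by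
  have hrank : Module.finrank ℝ (⋀[ℝ]^m (Fin n → ℝ)) = 0 := by
    rw [exteriorPower.finrank_eq, Module.finrank_fin_fun, Nat.choose_eq_zero_of_lt h]
  have := Module.Finite.of_basis (formBasis n m)
  have := Module.finrank_zero_iff.1 hrank
  exact congrArg Subtype.val (Subsingleton.elim (⟨a, ha⟩ : ⋀[ℝ]^m (Fin n → ℝ)) 0)

theorem wedgeRange_mul_wedgeRange {V : Type*} [AddCommGroup V] [Module ℝ V] (s : ℕ → V)
    (n m : ℕ) : wedgeRange s n * wedgeRange (fun i => s (n + i)) m = wedgeRange s (n + m) := by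
  induction m with
  | zero => simp [wedgeRange]
  | succ m ih => rw [wedgeRange_succ, ← mul_assoc, ih, ← add_assoc, wedgeRange_succ]

/-- The inclusion `ℝ^{NL} → ℝ^{(N+1)L}`, `e_i ↦ e_i`. -/
def inclusion (N L : ℕ) : (Fin (N * L) → ℝ) →ₗ[ℝ] (Fin ((N + 1) * L) → ℝ) :=
  Function.ExtendByZero.linearMap ℝ
    (Fin.castLE (Nat.mul_le_mul_right L (Nat.le_succ N)) : Fin (N * L) → Fin ((N + 1) * L))

theorem inclusion_e (N L : ℕ) (i : Fin (N * L)) :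
    inclusion N L (e i) = e (Fin.castLE (Nat.mul_le_mul_right L (Nat.le_succ N)) i) := by
  ext j
  change Function.extend _ (e i) (0 : Fin ((N + 1) * L) → ℝ) j = _
  by_cases hj : ∃ i', Fin.castLE (Nat.mul_le_mul_right L (Nat.le_succ N)) i' = j
  · obtain ⟨i', rfl⟩ := hj
    rw [(Fin.castLE_injective _).extend_apply]
    simp [e, Pi.single_apply]
  · rw [Function.extend_apply' _ _ _ hj]
    have : j ≠ Fin.castLE (Nat.mul_le_mul_right L (Nat.le_succ N)) i := fun h => hj ⟨i, h.symm⟩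
    simp [e, this]

theorem coe_extendForm {N L k : ℕ} (a : Form (N * L) k) :
    (extendForm N L a : ExteriorAlgebra ℝ (Fin ((N + 1) * L) → ℝ)) =
      ExteriorAlgebra.map (inclusion N L) (a : ExteriorAlgebra ℝ (Fin (N * L) → ℝ)) := by
  have h : (formSubtype _ k) ∘ₗ extendForm N L =
      (ExteriorAlgebra.map (inclusion N L)).toLinearMap ∘ₗ formSubtype (N * L) k := by
    apply exteriorPower.linearMap_ext
    ext v
    change ((extendForm N L (exteriorPower.ιMulti ℝ k v) : Form _ k) : ExteriorAlgebra ℝ _) =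
      ExteriorAlgebra.map (inclusion N L)
        ((exteriorPower.ιMulti ℝ k v : Form _ k) : ExteriorAlgebra ℝ _)
    rw [extendForm, exteriorPower.map_apply_ιMulti, exteriorPower.ιMulti_apply_coe,
      exteriorPower.ιMulti_apply_coe, ExteriorAlgebra.map_apply_ιMulti]
    rfl
  exact LinearMap.congr_fun h a

theorem coe_borderForm (N L : ℕ) :
    (borderForm N L : ExteriorAlgebra ℝ (Fin ((N + 1) * L) → ℝ)) =
      wedgeRange (fun i => eNat ((N + 1) * L) (N * L + i)) L := by
  rw [borderForm, basicForm, exteriorPower.ιMulti_apply_coe, wedgeRange]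
  congr 1
  ext1 i
  rw [eNat, dif_pos]

theorem map_inclusion_volForm (N L : ℕ) : ExteriorAlgebra.map (inclusion N L) (volForm (N * L)) =
    wedgeRange (eNat ((N + 1) * L)) (N * L) := by
  rw [volForm, ExteriorAlgebra.map_apply_ιMulti, wedgeRange]
  congr 1
  ext1 i
  rw [Function.comp_apply, inclusion_e, ← eNat_val]
  rfl

theorem volCoeff_map_mul_borderForm {N L : ℕ} {a : ExteriorAlgebra ℝ (Fin (N * L) → ℝ)}
    (ha : a ∈ ⋀[ℝ]^(N * L) (Fin (N * L) → ℝ)) :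
    volCoeff ((N + 1) * L) (ExteriorAlgebra.map (inclusion N L) a * borderForm N L) =
      volCoeff (N * L) a := by
  conv_lhs => rw [eq_volCoeff_smul ha]
  rw [map_smul, smul_mul_assoc, map_smul, map_inclusion_volForm, coe_borderForm,
    wedgeRange_mul_wedgeRange, ← Nat.succ_mul, volCoeff_wedgeRange_eNat, smul_eq_mul, mul_one]

theorem borderForm_mul_self {N L : ℕ} (hL : 0 < L) :
    (borderForm N L : ExteriorAlgebra ℝ (Fin ((N + 1) * L) → ℝ)) * borderForm N L = 0 := by
  rw [coe_borderForm]
  obtain ⟨l, rfl⟩ : ∃ l, L = l + 1 := ⟨L - 1, by omega⟩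
  conv_lhs =>
    arg 2
    rw [wedgeRange_succ_left]
  rw [← mul_assoc, wedgeRange_mul_ι (fun i => eNat ((N + 1) * (l + 1)) (N * (l + 1) + i))
    (Nat.succ_pos l), zero_mul]

/-- The linear map `a ↦ a ∧ ε'`, preceded by the inclusion of forms. -/
def wedgeBorder (N L : ℕ) : Form (N * L) L →ₗ[ℝ] Form ((N + 1) * L) (L + L) where
  toFun a := wedge (extendForm N L a) (borderForm N L)
  map_add' a b := Subtype.ext (by simp [wedge, add_mul])
  map_smul' c a := Subtype.ext (by simp [wedge])

/-- The border term squares to zero, and `η^(M+1) = 0` because its degree `2(M+1)L` exceeds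
`(2M+1)L`. The binomial expansion of the `(M+1)`-st power is then the single term `(M+1) η^M ∧ I ∧
ε'`. Here `ε'` completes the smaller volume form to the larger one, and `(M+1)/(M+1)! = 1/M!`. -/
theorem hyperpfaffian_extendForm_add {M L : ℕ} (hL : 0 < L)
    (η : Form ((2 * M + 1) * L) (L + L)) (I : Form ((2 * M + 1) * L) L) :
    hyperpfaffian (extendForm (2 * M + 1) L η + wedgeBorder (2 * M + 1) L I) =
      (M.factorial : ℝ)⁻¹ * volCoeff ((2 * M + 1) * L)
        ((I : ExteriorAlgebra ℝ (Fin ((2 * M + 1) * L) → ℝ)) *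
          (η : ExteriorAlgebra ℝ (Fin ((2 * M + 1) * L) → ℝ)) ^ M) := by
  have hM : (2 * M + 1 + 1) * L / (L + L) = M + 1 := by
    rw [show (2 * M + 1 + 1) * L = (M + 1) * (L + L) by ring, Nat.mul_div_cancel _ (by omega)]
  set Y := wedgeBorder (2 * M + 1) L I with hY
  have hYval : (Y : ExteriorAlgebra ℝ (Fin ((2 * M + 1 + 1) * L) → ℝ)) =
      ExteriorAlgebra.map (inclusion (2 * M + 1) L)
        (I : ExteriorAlgebra ℝ (Fin ((2 * M + 1) * L) → ℝ)) * borderForm (2 * M + 1) L := by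
    rw [← coe_extendForm]
    rfl
  have hYcomm := commute_of_mem_even ⟨L, rfl⟩ Y.2
  have hYY : (Y : ExteriorAlgebra ℝ (Fin ((2 * M + 1 + 1) * L) → ℝ)) * Y = 0 := by
    -- `Y` has even degree, so `ε'` can be moved past it to stand next to the other `ε'`.
    nth_rewrite 1 [hYval]
    rw [mul_assoc, ← (hYcomm _).eq, hYval, mul_assoc, borderForm_mul_self hL, mul_zero, mul_zero]
  have hηpow : ∀ m, (η : ExteriorAlgebra ℝ (Fin ((2 * M + 1) * L) → ℝ)) ^ m ∈
      ⋀[ℝ]^(m • (L + L)) (Fin ((2 * M + 1) * L) → ℝ) := fun m =>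
    SetLike.pow_mem_graded (A := fun i : ℕ => ⋀[ℝ]^i (Fin ((2 * M + 1) * L) → ℝ)) m η.2
  have hη0 : (η : ExteriorAlgebra ℝ (Fin ((2 * M + 1) * L) → ℝ)) ^ (M + 1) = 0 := by
    refine eq_zero_of_mem_of_lt ?_ (hηpow (M + 1))
    rw [smul_eq_mul]
    nlinarith
  have hmem : (I : ExteriorAlgebra ℝ (Fin ((2 * M + 1) * L) → ℝ)) * η ^ M ∈
      ⋀[ℝ]^((2 * M + 1) * L) (Fin ((2 * M + 1) * L) → ℝ) := by
    have := SetLike.mul_mem_graded (A := fun i : ℕ => ⋀[ℝ]^i (Fin ((2 * M + 1) * L) → ℝ))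
      I.2 (hηpow M)
    rwa [smul_eq_mul, show L + M * (L + L) = (2 * M + 1) * L by ring] at this
  have hηcomm := (commute_of_mem_even ⟨L, rfl⟩ η.2
    (I : ExteriorAlgebra ℝ (Fin ((2 * M + 1) * L) → ℝ))).pow_left M
  rw [hyperpfaffian, hM, Submodule.coe_add,
    add_pow_succ_of_mul_self_eq_zero (hYcomm _).symm hYY, coe_extendForm, ← map_pow, ← map_pow, hη0,
    map_zero, zero_add, hYval, ← mul_assoc (ExteriorAlgebra.map _ _), ← map_mul, hηcomm.eq,
    ← Nat.cast_succ, map_smul, volCoeff_natCast_mul, volCoeff_map_mul_borderForm hmem, smul_eq_mul,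
    Nat.factorial_succ]
  push_cast
  have : ((M : ℝ) + 1) ≠ 0 := by positivity
  field_simp

end HyperPf
end

/-! ### The four cases -/

theorem theorem1 (L N β : ℕ) (hL : 0 < L) (hN : 0 < N)
    (ν : MeasureTheory.Measure ℝ) [MeasureTheory.SigmaFinite ν]
    (hZpos : 0 < HyperPf.partitionFunction N β ν)
    (hZfin : HyperPf.partitionFunction N β ν < ⊤)
    (p : Fin (N * L) → Polynomial ℝ) (hp : HyperPf.IsCompleteMonic p) :
    (β = L ^ 2 → Even β →
      HyperPf.FormIntegrable ν (HyperPf.omega L p) ∧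
      (HyperPf.partitionFunction N β ν).toReal =
        HyperPf.hyperpfaffian (HyperPf.formIntegral ν (HyperPf.omega L p))) ∧
    (β = L ^ 2 → Odd β → Even N →
      HyperPf.FormIntegrable (ν.prod ν)
        (fun z => HyperPf.pairForm L p (fun x y => Real.sign (y - x)) z.1 z.2) ∧
      (HyperPf.partitionFunction N β ν).toReal =
        HyperPf.hyperpfaffian (HyperPf.doubleForm L p (fun x y => Real.sign (y - x)) ν)) ∧
    (β = L ^ 2 → Odd β → Odd N →
      HyperPf.FormIntegrable (ν.prod ν)
        (fun z => HyperPf.pairForm L p (fun x y => Real.sign (y - x)) z.1 z.2) ∧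
      HyperPf.FormIntegrable ν (fun x =>
        HyperPf.wedge (HyperPf.extendForm N L (HyperPf.omega L p x)) (HyperPf.borderForm N L)) ∧
      (HyperPf.partitionFunction N β ν).toReal =
        HyperPf.hyperpfaffian
          (HyperPf.extendForm N L (HyperPf.doubleForm L p (fun x y => Real.sign (y - x)) ν) +
            HyperPf.formIntegral ν fun x =>
              HyperPf.wedge (HyperPf.extendForm N L (HyperPf.omega L p x))
                (HyperPf.borderForm N L))) ∧
    (∀ M : ℕ, β = L ^ 2 + 1 → Even β → N = 2 * M →
      HyperPf.FormIntegrable (ν.prod ν)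
        (fun z => HyperPf.pairForm L p
          (fun x y => (y ^ M - x ^ M) ^ 2 / (y - x)) z.1 z.2) ∧
      (HyperPf.partitionFunction N β ν).toReal =
        HyperPf.hyperpfaffian (HyperPf.doubleForm L p
          (fun x y => (y ^ M - x ^ M) ^ 2 / (y - x)) ν)) := by
  refine ⟨?_, ?_, ?_, ?_⟩
  · rintro rfl hβ
    have hint := HyperPf.formIntegrable_omega hN hZpos hZfin hp
    exact ⟨hint, (HyperPf.hyperpfaffian_formIntegral_omega hL hβ hp hint).symm⟩
  · rintro rfl hβ hNeven
    obtain ⟨M, rfl⟩ := even_iff_exists_two_mul.1 hNeven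
    have hint := HyperPf.formIntegrable_pairForm_sign hN hZpos hZfin hp
    exact ⟨hint, (HyperPf.hyperpfaffian_doubleForm hL hβ hp hint
      (HyperPf.antisymmetrization_mul_pow_of_injective hβ fun x hx =>
        HyperPf.antisymmetrization_sign_even M hx)).symm⟩
  · rintro rfl hβ ⟨M, rfl⟩
    have hω := HyperPf.formIntegrable_omega hN hZpos hZfin hp
    have hint := HyperPf.formIntegrable_pairForm_sign hN hZpos hZfin hp
    -- Wedging with `ε'` is linear, hence commutes with integration; this gives both the convergence
    -- and the value of the border integral.
    have hborder := hω.hasWeakIntegral.map (HyperPf.wedgeBorder (2 * M + 1) L)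
    refine ⟨hint, hborder.formIntegrable, ?_⟩
    have hfac : (M.factorial : ℝ) ≠ 0 := by exact_mod_cast M.factorial_ne_zero
    have h := HyperPf.hyperpfaffian_extendForm_add hL
      (HyperPf.doubleForm L p (fun x y => Real.sign (y - x)) ν)
      (HyperPf.formIntegral ν (HyperPf.omega L p))
    rw [← hborder.formIntegral_eq, HyperPf.volCoeff_omega_mul_doubleForm_pow hβ hp hω hint,
      inv_mul_cancel_left₀ hfac] at h
    exact h.symm
  · rintro M rfl hβ rfl
    have hint := HyperPf.formIntegrable_pairForm_sq_sub hN rfl hZpos hZfin hp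
    -- As `L^2 + 1` is even, `L^2` is odd, so the antisymmetrization argument applies and `Δ ·
    -- Δ^(L^2) = |Δ|^(L^2+1)`.
    have hodd : Odd (L ^ 2) := by
      rw [Nat.even_add_one, Nat.not_even_iff_odd] at hβ
      exact hβ
    refine ⟨hint, (HyperPf.hyperpfaffian_doubleForm hL hodd hp hint fun x => ?_).symm⟩
    rw [HyperPf.antisymmetrization_sq_sub, hβ.pow_abs, mul_assoc,
      pow_succ' (Matrix.vandermonde x).det]
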